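/- Let $\Pi$ be a Poisson process of intensity $1$ on $\mathbb{R}$, with random point set $[\Pi]$. A simple graph $G$ with vertex set $[\Pi]$ is a *2-stub stable multi-matching* if every vertex has degree exactly $2$ and, for any two distinct points $x,y\in[\Pi]$, either they are linked by an edge or at least one of them has no incident edge longer than $|x-y|$. For a bounded interval $I=[a,b]$, the *core multi-matching* on $I$ is the graph on $P=[\Pi]\cap I$ produced by the following algorithm. Put $\widetilde P=P\cup\{I^c\}$, where $I^c=\mathbb{R}\setminus I$ is treated as one additional point whose distance to $x\in P$ is $\operatorname{dist}(x,I^c)$. (Almost surely all distances between pairs of elements of $\widetilde P$ are distinct.) Assign two stubs to each $x\in P$ and one stub to $I^c$, and start without edges. In each round, each $x\in P$ with an unused stub gets an arrow pointing to the closest other element of $\widetilde P$ among those that have at least one unused stub and do not already have an edge to $x$; then any two points $x,y\in P$ whose arrows point to each other are linked by an edge, one stub is removed from each of them, and all arrows are erased. Rounds are repeated until no more edges are added (the stub of $I^c$ is never used). The interval $[a,b]$ is *good* if its core multi-matching has a connected component with a point in the first quarter $[a,\tfrac34a+\tfrac14b]$ and a point in the last quarter $[\tfrac14a+\tfrac34b,b]$.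 **Theorem.** If $\mathbb{P}([0,L]\text{ is good})>0.968$ for some $L$, then almost surely there is a unique 2-stub stable multi-matching of $[\Pi]$, and it has a connected component with infinitely many vertices. -/

import Mathlib

open MeasureTheory ProbabilityTheory Set

/-- The random set `X` (the set of points of a point process on `ℝ`) is a homogeneous Poisson
process of intensity `1` under `Pr`: its realizations are locally finite, the number of points in
a bounded Borel set `B` is a Poisson random variable with mean the length of `B`, and the numbers
of points in finitely many pairwise disjoint bounded Borel sets are independent. -/
structure IsUnitPoissonProcess {Ω : Type*} [MeasurableSpace Ω] (Pr : Measure Ω)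
    (X : Ω → Set ℝ) : Prop where
  locallyFinite : ∀ ω, ∀ B : Set ℝ, Bornology.IsBounded B → (X ω ∩ B).Finite
  measurable_count : ∀ B : Set ℝ, MeasurableSet B → Bornology.IsBounded B →
    Measurable fun ω => (X ω ∩ B).ncard
  map_count : ∀ B : Set ℝ, MeasurableSet B → Bornology.IsBounded B →
    Pr.map (fun ω => (X ω ∩ B).ncard) = poissonMeasure (volume B).toNNReal
  indep_count : ∀ (n : ℕ) (B : Fin n → Set ℝ), (∀ i, MeasurableSet (B i)) →
    (∀ i, Bornology.IsBounded (B i)) → (Pairwise fun i j => Disjoint (B i) (B j)) →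
    iIndepFun (fun i ω => (X ω ∩ B i).ncard) Pr

/-- `G` is a stable multi-matching of the point set `P` in which each `x ∈ P` has `D x` stubs.
Graphs with vertex set `P` are represented by graphs on `ℝ` all of whose edges join points of `P`
(so that every real number outside `P` is isolated). -/
structure IsStableMultiMatching (P : Set ℝ) (D : ℝ → ℕ) (G : SimpleGraph ℝ) : Prop where
  mem_of_adj : ∀ x y, G.Adj x y → x ∈ P ∧ y ∈ P
  degree_eq : ∀ x ∈ P, (G.neighborSet x).encard = D x
  /-- Two distinct points are linked, or one of them has no incident edge longer than their
  distance. -/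
  stable : ∀ x ∈ P, ∀ y ∈ P, x ≠ y →
    G.Adj x y ∨ (∀ z, G.Adj x z → dist x z ≤ dist x y) ∨ (∀ z, G.Adj y z → dist y z ≤ dist x y)

/-- The point `x` of `P` still has an unused stub when the edges of `G` have been drawn. -/
def HasUnusedStub (P : Set ℝ) (D : ℝ → ℕ) (G : SimpleGraph ℝ) (x : ℝ) : Prop :=
  x ∈ P ∧ (G.neighborSet x).encard < D x

/-- `x` and `z` are distinct points of `P`, both with an unused stub, with no edge between them. -/
def Compatible (P : Set ℝ) (D : ℝ → ℕ) (G : SimpleGraph ℝ) (x z : ℝ) : Prop :=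
  HasUnusedStub P D G x ∧ HasUnusedStub P D G z ∧ x ≠ z ∧ ¬ G.Adj x z

/-- When the edges of `G` have been drawn, the arrow of `x` points to the point `y` of `P`: among
the points of `P` compatible with `x` and the additional element `Sᶜ` (which always keeps its stub
and is never linked), `y` is the closest to `x`. -/
def Arrow (S P : Set ℝ) (D : ℝ → ℕ) (G : SimpleGraph ℝ) (x y : ℝ) : Prop :=
  Compatible P D G x y ∧ dist x y < Metric.infDist x Sᶜ ∧
    ∀ z, Compatible P D G x z → z ≠ y → dist x y < dist x z

/-- One round of the core matching algorithm: link all pairs whose arrows point to each other. -/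
def coreStep (S P : Set ℝ) (D : ℝ → ℕ) (G : SimpleGraph ℝ) : SimpleGraph ℝ where
  Adj x y := G.Adj x y ∨ (Arrow S P D G x y ∧ Arrow S P D G y x)
  symm := ⟨fun _ _ h => h.imp (fun h => h.symm) And.symm⟩
  loopless := ⟨fun _ h => h.elim G.irrefl fun h => h.1.1.2.2.1 rfl⟩

/-- The core multi-matching of `(P, D)` in `S` (used for bounded `S` and finite `P ⊆ S`): all edges
drawn in some round, starting from the graph without edges. -/
def coreMatching (S P : Set ℝ) (D : ℝ → ℕ) : SimpleGraph ℝ :=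
  ⨆ n : ℕ, (coreStep S P D)^[n] ⊥

/-- The interval `[a, b]` is good for the point set `P`: the core multi-matching of `P ∩ [a, b]` in
`[a, b]` with two stubs per point has a connected component with a point in the first quarter and a
point in the last quarter of the interval. -/
def IsGood (P : Set ℝ) (a b : ℝ) : Prop :=
  ∃ x ∈ P ∩ Icc a b, ∃ y ∈ P ∩ Icc a b,
    x ∈ Icc a (3 / 4 * a + 1 / 4 * b) ∧ y ∈ Icc (1 / 4 * a + 3 / 4 * b) b ∧
      (coreMatching (Icc a b) (P ∩ Icc a b) fun _ => 2).Reachable x y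

/-- The graph `G` has a connected component with infinitely many vertices. -/
def HasInfiniteComponent (G : SimpleGraph ℝ) : Prop :=
  ∃ C : G.ConnectedComponent, C.supp.Infinite

/-! The deterministic part rests on `IsPartialStable`, a property shared by core matchings and
stable multi-matchings. On the line it forces planarity: when two edges cross, their inner endpoints
are linked (`adj_of_crossing`). Hence components with interlacing ranges coincide
(`reachable_of_alternating`), and every point between two points of one component has both stubs
used (`isFull_of_between`). A parity count adds that an end of a finite component with more than one
point either keeps an unused stub or is linked to the opposite end (`adj_of_isFull_left`).

In a core matching, let two components be separated by a gap shorter than both. By the parity fact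
and stability, both points facing the gap keep a stub; but then the closest compatible pair inside
the gap would have been linked. So long components bridge short gaps (`exists_bridge`). Consequently
an interval of length `7 * L` can be bad only if two adjacent intervals of length `L`, at multiples
of `L / 2`, are both bad. With `q` the probability of being bad, independence and stationarity give
`q (7 * L) ≤ 11 * q L ^ 2`. Starting from `q L ≤ 1 / 22` this decays geometrically along the scales
`7 ^ n * L`, and by Borel–Cantelli all intervals in finitely many relative positions are good at
every large scale.

Core edges are local: they survive in larger intervals and lie in every stable multi-matching
(`coreMatching_le`). Good intervals around the origin saturate every point, so the increasing union
of core matchings is a stable multi-matching, and it is the only one, since no point has room for a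
further edge. Good intervals to the right of the origin interlace with each other and with those of
the next scale, so a single component is unbounded. -/

/-! ### Partially stable graphs on the line: planarity and parity. -/

/-- Two distinct edges at `x`. -/
def IsFull (G : SimpleGraph ℝ) (x : ℝ) : Prop :=
  ∃ a b, a ≠ b ∧ G.Adj x a ∧ G.Adj x b

/-- A graph on `P` with all degrees at most two such that two unlinked points, one of which has an
edge longer than their distance, never both prefer each other: the other point has two edges,
neither of them longer than the distance. -/
structure IsPartialStable (P : Set ℝ) (G : SimpleGraph ℝ) : Prop where
  mem : ∀ {x y}, G.Adj x y → x ∈ P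
  deg : ∀ {x a b c}, G.Adj x a → G.Adj x b → G.Adj x c → a = b ∨ a = c ∨ b = c
  stab : ∀ {x y z}, y ∈ P → x ≠ y → ¬ G.Adj x y → G.Adj x z → dist x y < dist x z →
    IsFull G y ∧ ∀ w, G.Adj y w → dist y w ≤ dist x y

theorem exists_boundary_adj {V : Type*} {G : SimpleGraph V} {u v : V} (h : G.Reachable u v)
    {A : Set V} (hu : u ∈ A) (hv : v ∉ A) :
    ∃ p q, p ∈ A ∧ q ∉ A ∧ G.Adj p q ∧ G.Reachable u p ∧ G.Reachable u q := by
  obtain ⟨w⟩ := h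
  induction w with
  | nil => exact absurd hu hv
  | @cons a b c hab w ih =>
    by_cases hb : b ∈ A
    · obtain ⟨p, q, hp, hq, hpq, h1, h2⟩ := ih hb hv
      exact ⟨p, q, hp, hq, hpq, hab.reachable.trans h1, hab.reachable.trans h2⟩
    · exact ⟨a, b, hu, hb, hab, .refl _, hab.reachable⟩

theorem dist_of_lt {a b : ℝ} (h : a < b) : dist a b = b - a := by
  rw [Real.dist_eq, abs_sub_comm, abs_of_pos (by linarith)]

theorem dist_of_gt {a b : ℝ} (h : b < a) : dist a b = a - b := by
  rw [Real.dist_eq, abs_of_pos (by linarith)]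

namespace IsPartialStable

variable {P : Set ℝ} {G : SimpleGraph ℝ}

/-- If `b` and `c` were not linked, the edge `c a`, being longer than `b c`, would force all edges
at `b` to have length at most `c - b`, which `b d` violates. -/
theorem adj_of_crossing (h : IsPartialStable P G) {a b c d : ℝ} (hab : a < b) (hbc : b < c)
    (hcd : c < d) (hac : G.Adj a c) (hbd : G.Adj b d) : G.Adj b c := by
  by_contra hn
  have := (h.stab (x := c) (y := b) (z := a) (h.mem hbd) hbc.ne' (fun h => hn h.symm) hac.symm
    (by rw [dist_of_gt hbc, dist_of_gt (hab.trans hbc)]; linarith)).2 d hbd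
  rw [dist_of_gt hbc, dist_of_lt (hbc.trans hcd)] at this
  linarith

/-- A component that does not contain the edge `p q` lies entirely below it or entirely outside. -/
theorem mem_Ioo_of_reachable (h : IsPartialStable P G) {p q x y : ℝ} (hpq : G.Adj p q)
    (hxy : G.Reachable x y) (hx : x ∈ Ioo p q) (hpx : ¬ G.Reachable p x) : y ∈ Ioo p q := by
  by_contra hy
  obtain ⟨s, t, hs, ht, hst, hxs, hxt⟩ := exists_boundary_adj hxy hx hy
  have hps : ¬ G.Reachable p s := fun h => hpx (h.trans hxs.symm)
  have hpt : ¬ G.Reachable p t := fun h => hpx (h.trans hxt.symm)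
  have htp : t ≠ p := fun h => hpt (h ▸ .refl _)
  have htq : t ≠ q := fun h => hpt (h ▸ hpq.reachable)
  rcases lt_or_ge t p with h1 | h1
  · exact hps (h.adj_of_crossing h1 hs.1 hs.2 hst.symm hpq).reachable
  rcases lt_or_ge q t with h2 | h2
  · exact hps (hpq.reachable.trans (h.adj_of_crossing hs.1 hs.2 h2 hpq hst).symm.reachable)
  · exact ht ⟨lt_of_le_of_ne h1 htp.symm, lt_of_le_of_ne h2 htq⟩

/-- Components of a partially stable graph do not cross. -/
theorem reachable_of_alternating (h : IsPartialStable P G) {x u y v : ℝ} (hxu : x ≤ u)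
    (huy : u ≤ y) (hyv : y ≤ v) (hxy : G.Reachable x y) (huv : G.Reachable u v) :
    G.Reachable x u := by
  rcases hxu.eq_or_lt with rfl | hxu
  · exact .refl _
  rcases huy.eq_or_lt with rfl | huy
  · exact hxy
  rcases hyv.eq_or_lt with rfl | hyv
  · exact hxy.trans huv.symm
  by_contra hn
  obtain ⟨p, q, hp, hq, hpq, hup, huq⟩ :=
    exists_boundary_adj huv (A := Ioo x y) ⟨hxu, huy⟩ (fun h => lt_asymm h.2 hyv)
  have hxp : ¬ G.Reachable p x := fun h => hn (hup.trans h).symm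
  have hxq : ¬ G.Reachable q x := fun h => hn (huq.trans h).symm
  have hyp : ¬ G.Reachable p y := fun h => hxp (h.trans hxy.symm)
  have hqx : q ≠ x := fun h => hxq (h ▸ .refl _)
  have hqy : q ≠ y := fun h => hxq (h ▸ hxy.symm)
  rcases lt_or_ge q x with h1 | h1
  · exact lt_asymm hp.2 (h.mem_Ioo_of_reachable hpq.symm hxy ⟨h1, hp.1⟩ hxq).2
  rcases lt_or_ge y q with h2 | h2
  · exact lt_asymm hp.1 (h.mem_Ioo_of_reachable hpq hxy.symm ⟨hp.2, h2⟩ hyp).1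
  · exact hq ⟨lt_of_le_of_ne h1 hqx.symm, lt_of_le_of_ne h2 hqy⟩

/-- An end of the covering edge that is not linked to `w` prefers `w` to its partner, so stability
makes `w` full. If both ends are linked to `w`, these are its two edges. -/
theorem isFull_of_covered (h : IsPartialStable P G) {p q w : ℝ} (hpq : G.Adj p q) (hw : w ∈ P)
    (hpw : p < w) (hwq : w < q) : IsFull G w := by
  by_cases h1 : G.Adj p w
  · by_cases h2 : G.Adj q w
    · exact ⟨p, q, (hpw.trans hwq).ne, h1.symm, h2.symm⟩
    · exact (h.stab hw hwq.ne' h2 hpq.symm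
        (by rw [dist_of_gt hwq, dist_of_gt (hpw.trans hwq)]; linarith)).1
  · exact (h.stab hw hpw.ne h1 hpq
        (by rw [dist_of_lt hpw, dist_of_lt (hpw.trans hwq)]; linarith)).1

/-- Points between two points of the same component have both stubs used. -/
theorem isFull_of_between (h : IsPartialStable P G) {l r w : ℝ} (hlr : G.Reachable l r)
    (hw : w ∈ P) (hlw : l < w) (hwr : w < r) : IsFull G w := by
  -- A path past `w` either jumps over `w`, which is the covered case, or lands on it. If it lands
  -- from both sides, `w` has one neighbour on each side.
  obtain ⟨p, q, hp, hq, hpq, -, -⟩ := exists_boundary_adj hlr (A := Iio w) hlw (not_lt.2 hwr.le)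
  obtain ⟨p', q', hp', hq', hpq', -, -⟩ :=
    exists_boundary_adj hlr.symm (A := Ioi w) hwr (not_lt.2 hlw.le)
  simp only [mem_Iio, not_lt, mem_Ioi] at hp hq hp' hq'
  rcases hq.eq_or_lt with rfl | hq
  · rcases hq'.eq_or_lt with rfl | hq'
    · exact ⟨p, p', (hp.trans hp').ne, hpq.symm, hpq'.symm⟩
    · exact h.isFull_of_covered hpq'.symm hw hq' hp'
  · exact h.isFull_of_covered hpq hw hp hq

/-- Handshake argument: in the graph induced on `B`, the point `n` has degree one and all others
have degree two, but the number of odd vertices is even. -/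
theorem no_single_exit (h : IsPartialStable P G) {B : Set ℝ} (hB : B.Finite) {n l : ℝ}
    (hn : n ∈ B) (hl : l ∉ B) (hnl : G.Adj n l)
    (hexit : ∀ s ∈ B, ∀ t, G.Adj s t → t ∈ B ∨ (s = n ∧ t = l)) (hfull : ∀ s ∈ B, IsFull G s) :
    False := by
  classical
  have := hB.fintype
  let H := G.induce B
  have hdeg (s : B) : Odd (H.degree s) → s = ⟨n, hn⟩ := by
    intro ho
    by_contra hs
    have hs' : (s : ℝ) ≠ n := fun h => hs (Subtype.ext h)
    obtain ⟨a, b, hab, ha, hb⟩ := hfull s s.2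
    have ha' : a ∈ B := (hexit s s.2 a ha).resolve_right fun h => hs' h.1
    have hb' : b ∈ B := (hexit s s.2 b hb).resolve_right fun h => hs' h.1
    have : H.neighborFinset s = {⟨a, ha'⟩, ⟨b, hb'⟩} := by
      ext t
      simp only [SimpleGraph.mem_neighborFinset, Finset.mem_insert, Finset.mem_singleton]
      constructor
      · intro ht
        have ht : G.Adj s t := ht
        rcases h.deg ha hb ht with h1 | h1 | h1
        · exact absurd h1 hab
        · exact .inl (Subtype.ext h1.symm)
        · exact .inr (Subtype.ext h1.symm)
      · rintro (rfl | rfl)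
        · exact ha
        · exact hb
    rw [← SimpleGraph.card_neighborFinset_eq_degree, this, Finset.card_pair] at ho
    · exact absurd ho (by decide)
    · intro h; exact hab (congrArg Subtype.val h)
  have hone : Odd (H.degree ⟨n, hn⟩) := by
    obtain ⟨a, b, hab, ha, hb⟩ := hfull n hn
    obtain ⟨m, hm, hml⟩ : ∃ m, G.Adj n m ∧ m ≠ l := by
      by_cases hal : a = l
      · exact ⟨b, hb, fun h => hab (hal.trans h.symm)⟩
      · exact ⟨a, ha, hal⟩
    have hm' : m ∈ B := (hexit n hn m hm).resolve_right fun h => hml h.2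
    have : H.neighborFinset ⟨n, hn⟩ = {⟨m, hm'⟩} := by
      ext t
      simp only [SimpleGraph.mem_neighborFinset, Finset.mem_singleton]
      constructor
      · intro ht
        have ht : G.Adj n t := ht
        rcases h.deg hm hnl ht with h1 | h1 | h1
        · exact absurd h1 hml
        · exact Subtype.ext h1.symm
        · exact absurd t.2 (h1 ▸ hl)
      · rintro rfl; exact hm
    rw [← SimpleGraph.card_neighborFinset_eq_degree, this, Finset.card_singleton]
    exact odd_one
  obtain ⟨w, hw, hwo⟩ := H.exists_ne_odd_degree_of_exists_odd_degree ⟨n, hn⟩ hone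
  exact hw (hdeg w hwo)

/-- The leftmost point of a bounded component has an unused stub or is linked to the rightmost
point. -/
theorem adj_of_isFull_left (h : IsPartialStable P G) (hP : P.Finite) {l r : ℝ}
    (hlr : G.Reachable l r) (hlt : l < r) (hmin : ∀ c, G.Reachable l c → l ≤ c)
    (hmax : ∀ c, G.Reachable l c → c ≤ r) (hl : IsFull G l) : G.Adj l r := by
  by_contra hnlr
  obtain ⟨n1, n2, h12, hl1, hl2⟩ : ∃ n1 n2, n1 < n2 ∧ G.Adj l n1 ∧ G.Adj l n2 := by
    obtain ⟨a, b, hab, ha, hb⟩ := hl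
    rcases lt_or_gt_of_ne hab with h | h
    exacts [⟨a, b, h, ha, hb⟩, ⟨b, a, h, hb, ha⟩]
  have hadjl : ∀ t, G.Adj l t → t = n1 ∨ t = n2 := fun t ht => by
    rcases h.deg hl1 hl2 ht with h | h | h
    exacts [absurd h h12.ne, .inl h.symm, .inr h.symm]
  have hln1 : l < n1 := lt_of_le_of_ne (hmin _ hl1.reachable) hl1.ne
  have hn2r : n2 < r := lt_of_le_of_ne (hmax _ hl2.reachable) fun e => hnlr (e ▸ hl2)
  obtain ⟨p, q, hp, hq, hpq, hrp, hrq⟩ :=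
    exists_boundary_adj hlr.symm (A := Ioi n2) hn2r (not_lt.2 (hln1.trans h12).le)
  simp only [mem_Ioi, not_lt] at hp hq
  have hlq : l < q := by
    refine lt_of_le_of_ne (hmin _ (hlr.trans hrq)) ?_
    rintro rfl
    rcases hadjl p hpq.symm with rfl | rfl
    · exact lt_asymm hp h12
    · exact lt_irrefl _ hp
  have hqn : q ≠ n2 → G.Adj q n2 := fun hne =>
    h.adj_of_crossing hlq (lt_of_le_of_ne hq hne) hp hl2 hpq.symm
  have hdeg3 : ∀ {x a b c : ℝ}, G.Adj x a → G.Adj x b → G.Adj x c → a ≠ b → a ≠ c → b ≠ c → False :=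
    fun ha hb hc h1 h2 h3 => by
      rcases h.deg ha hb hc with h | h | h
      exacts [h1 h, h2 h, h3 h]
  have hn2 : ∀ s, l < s → s < n2 → s ≠ q → ¬ G.Adj s n2 := by
    intro s hls hs hsq hadj
    by_cases e : q = n2
    · subst e
      exact hdeg3 hl2.symm hpq.symm hadj.symm (by linarith) hls.ne (by linarith)
    · exact hdeg3 hl2.symm (hqn e).symm hadj.symm hlq.ne hls.ne hsq.symm
  refine h.no_single_exit (B := {v | v ∈ P ∧ l < v ∧ v < n2 ∧ v ≠ q}) (n := n1) (l := l)
    (hP.subset fun v hv => hv.1) ⟨h.mem hl1.symm, hln1, h12, ?_⟩ (fun h => lt_irrefl _ h.2.1)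
    hl1.symm ?_ ?_
  · rintro rfl
    exact hdeg3 (hqn h12.ne) hpq.symm hl1.symm hp.ne (hln1.trans h12).ne' (by linarith)
  · rintro s ⟨-, hls, hsn, hsq⟩ t hst
    rcases lt_trichotomy t l with htl | rfl | htl
    · have := h.adj_of_crossing htl hls hsn hst.symm hl2
      exact absurd (hmin t (this.reachable.trans hst.reachable)) (not_le.2 htl)
    · exact .inr ⟨(hadjl s hst.symm).resolve_right hsn.ne, rfl⟩
    rcases lt_trichotomy t n2 with htn | rfl | htn
    · refine .inl ⟨h.mem hst.symm, htl, htn, ?_⟩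
      rintro rfl
      exact hdeg3 (hqn htn.ne) hpq.symm hst.symm hp.ne hsn.ne' (by linarith)
    · exact absurd hst (hn2 s hls hsn hsq)
    · exact absurd (h.adj_of_crossing hls hsn htn hl2 hst) (hn2 s hls hsn hsq)
  · rintro s ⟨hs, hls, hsn, -⟩
    exact h.isFull_of_between hlr hs hls (hsn.trans hn2r)

theorem comap_neg (h : IsPartialStable P G) :
    IsPartialStable (Neg.neg ⁻¹' P) (G.comap Neg.neg) where
  mem hxy := h.mem hxy
  deg ha hb hc := by simpa using h.deg ha hb hc
  stab {x y z} hy hne hn hxz hlt := by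
    have := h.stab (x := -x) (y := -y) (z := -z) hy (by simpa using hne) hn hxz (by simpa using hlt)
    refine ⟨?_, fun w hw => by simpa using this.2 (-w) hw⟩
    obtain ⟨a, b, hab, ha, hb⟩ := this.1
    exact ⟨-a, -b, by simpa using hab, by simpa using ha, by simpa using hb⟩

theorem adj_of_isFull_right (h : IsPartialStable P G) (hP : P.Finite) {l r : ℝ}
    (hlr : G.Reachable l r) (hlt : l < r) (hmin : ∀ c, G.Reachable l c → l ≤ c)
    (hmax : ∀ c, G.Reachable l c → c ≤ r) (hr : IsFull G r) : G.Adj l r := by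
  let e : G.comap Neg.neg ≃g G := ⟨Equiv.neg ℝ, Iff.rfl⟩
  have hre : ∀ a b, (G.comap Neg.neg).Reachable a b ↔ G.Reachable (-a) (-b) := fun a b =>
    (SimpleGraph.Iso.reachable_iff (φ := e)).symm
  have := h.comap_neg.adj_of_isFull_left (l := -r) (r := -l) (hP.preimage neg_injective.injOn)
    ((hre _ _).2 (by simpa using hlr.symm)) (by linarith)
    (fun c hc => by
      have := hmax (-c) (hlr.trans (by simpa using (hre _ _).1 hc))
      linarith)
    (fun c hc => by
      have := hmin (-c) (hlr.trans (by simpa using (hre _ _).1 hc))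
      linarith)
    (by
      obtain ⟨a, b, hab, ha, hb⟩ := hr
      exact ⟨-a, -b, by simpa using hab, by simpa using ha, by simpa using hb⟩)
  have : G.Adj (-(-r)) (-(-l)) := this
  simpa using this.symm

end IsPartialStable

/-! ### The core algorithm with two stubs: stability, termination, locality. -/

theorem one_lt_encard_neighborSet_iff {G : SimpleGraph ℝ} {x : ℝ} :
    1 < (G.neighborSet x).encard ↔ IsFull G x := by
  rw [Set.one_lt_encard_iff]
  constructor
  · rintro ⟨a, b, ha, hb, hab⟩
    exact ⟨a, b, hab, ha, hb⟩
  · rintro ⟨a, b, hab, ha, hb⟩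
    exact ⟨a, b, ha, hb, hab⟩

theorem hasUnusedStub_two_iff {P : Set ℝ} {G : SimpleGraph ℝ} {x : ℝ} :
    HasUnusedStub P (fun _ => 2) G x ↔ x ∈ P ∧ ¬ IsFull G x := by
  rw [HasUnusedStub, ← one_lt_encard_neighborSet_iff, not_lt]
  refine and_congr_right fun _ => ?_
  have : ((2 : ℕ) : ℕ∞) = 1 + 1 := by norm_num
  rw [this]
  exact ENat.lt_add_one_iff (by norm_num)

theorem IsFull.mono {G H : SimpleGraph ℝ} (hGH : G ≤ H) {x : ℝ} (h : IsFull G x) : IsFull H x := by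
  obtain ⟨a, b, hab, ha, hb⟩ := h
  exact ⟨a, b, hab, hGH ha, hGH hb⟩

theorem compatible_two_iff {P : Set ℝ} {G : SimpleGraph ℝ} {x z : ℝ} :
    Compatible P (fun _ => 2) G x z ↔
      x ∈ P ∧ z ∈ P ∧ ¬ IsFull G x ∧ ¬ IsFull G z ∧ x ≠ z ∧ ¬ G.Adj x z := by
  rw [Compatible, hasUnusedStub_two_iff, hasUnusedStub_two_iff]
  tauto

theorem IsPartialStable.adj_of_le {P : Set ℝ} {G H : SimpleGraph ℝ} (hH : IsPartialStable P H)
    (hGH : G ≤ H) {x y : ℝ} (hx : IsFull G x) (hxy : H.Adj x y) : G.Adj x y := by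
  obtain ⟨a, b, hab, ha, hb⟩ := hx
  rcases hH.deg (hGH ha) (hGH hb) hxy with h | h | h
  exacts [absurd h hab, h ▸ ha, h ▸ hb]

section Core

variable (S P : Set ℝ)

/-- The graph after `k` rounds of the core matching algorithm with two stubs per point. -/
def coreRound (k : ℕ) : SimpleGraph ℝ := (coreStep S P fun _ => 2)^[k] ⊥

variable {S P}

theorem coreRound_zero : coreRound S P 0 = ⊥ := rfl

theorem coreRound_succ (k : ℕ) :
    coreRound S P (k + 1) = coreStep S P (fun _ => 2) (coreRound S P k) :=
  Function.iterate_succ_apply' _ _ _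

theorem coreRound_mono : Monotone (coreRound S P) :=
  monotone_nat_of_le_succ fun k => by
    rw [coreRound_succ]
    exact fun x y h => .inl h

theorem coreMatching_adj_iff {x y : ℝ} :
    (coreMatching S P fun _ => 2).Adj x y ↔ ∃ k, (coreRound S P k).Adj x y := by
  simp [coreMatching, coreRound]

theorem coreRound_le (k : ℕ) : coreRound S P k ≤ coreMatching S P fun _ => 2 :=
  fun _ _ h => coreMatching_adj_iff.2 ⟨k, h⟩

theorem coreRound_mem {k : ℕ} {x y : ℝ} (h : (coreRound S P k).Adj x y) : x ∈ P := by
  induction k with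
  | zero => exact absurd h (by simp [coreRound_zero])
  | succ k ih =>
    rw [coreRound_succ] at h
    rcases h with h | h
    exacts [ih h, h.1.1.1.1]

theorem Arrow.unique {D : ℝ → ℕ} {G : SimpleGraph ℝ} {x a b : ℝ} (ha : Arrow S P D G x a)
    (hb : Arrow S P D G x b) : a = b := by
  by_contra hab
  exact lt_asymm (ha.2.2 b hb.1 (Ne.symm hab)) (hb.2.2 a ha.1 hab)

theorem coreRound_deg {k : ℕ} {x a b c : ℝ} (ha : (coreRound S P k).Adj x a)
    (hb : (coreRound S P k).Adj x b) (hc : (coreRound S P k).Adj x c) : a = b ∨ a = c ∨ b = c := by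
  induction k generalizing a b c with
  | zero => exact absurd ha (by simp [coreRound_zero])
  | succ k ih =>
    by_contra! hne
    have key : ∀ {a b c : ℝ}, a ≠ b → (coreRound S P k).Adj x a → (coreRound S P k).Adj x b →
        ¬ Arrow S P (fun _ => 2) (coreRound S P k) x c := fun hab ha hb h =>
      (hasUnusedStub_two_iff.1 h.1.1).2 ⟨_, _, hab, ha, hb⟩
    rw [coreRound_succ] at ha hb hc
    rcases ha with ha | ⟨ha, -⟩ <;> rcases hb with hb | ⟨hb, -⟩ <;> rcases hc with hc | ⟨hc, -⟩
    · rcases ih ha hb hc with h | h | h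
      exacts [hne.1 h, hne.2.1 h, hne.2.2 h]
    · exact key hne.1 ha hb hc
    · exact key hne.2.1 ha hc hb
    · exact hne.2.2 (hb.unique hc)
    · exact key hne.2.2 hb hc ha
    · exact hne.2.1 (ha.unique hc)
    · exact hne.1 (ha.unique hb)
    · exact hne.1 (ha.unique hb)

theorem coreMatching_deg {x a b c : ℝ} (ha : (coreMatching S P fun _ => 2).Adj x a)
    (hb : (coreMatching S P fun _ => 2).Adj x b) (hc : (coreMatching S P fun _ => 2).Adj x c) :
    a = b ∨ a = c ∨ b = c := by
  obtain ⟨i, hi⟩ := coreMatching_adj_iff.1 ha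
  obtain ⟨j, hj⟩ := coreMatching_adj_iff.1 hb
  obtain ⟨k, hk⟩ := coreMatching_adj_iff.1 hc
  exact coreRound_deg (k := max i (max j k)) (coreRound_mono (by simp) hi)
    (coreRound_mono (by simp) hj) (coreRound_mono (by simp) hk)

theorem exists_round_of_adj {x z : ℝ} (h : (coreMatching S P fun _ => 2).Adj x z) :
    ∃ k, ¬ (coreRound S P k).Adj x z ∧ Arrow S P (fun _ => 2) (coreRound S P k) x z := by
  classical
  have h := coreMatching_adj_iff.1 h
  obtain ⟨k, hk⟩ : ∃ k, Nat.find h = k + 1 := by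
    refine Nat.exists_eq_succ_of_ne_zero fun h0 => ?_
    have := Nat.find_spec h
    rw [h0] at this
    exact absurd this (by simp [coreRound_zero])
  have h1 := Nat.find_spec h
  have h2 := Nat.find_min h (m := k) (by omega)
  rw [hk, coreRound_succ] at h1
  exact ⟨k, h2, (h1.resolve_left h2).1⟩

/-- When the edge `x z` is drawn, the closer point `y` was passed over, so `y` is already full. Its
edges were drawn while `x` still had a stub, so `y` preferred its partners to `x`. Arrows demand
strict minimality, hence no genericity of distances is needed here. -/
theorem isPartialStable_coreMatching : IsPartialStable P (coreMatching S P fun _ => 2) where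
  mem h := by
    obtain ⟨k, hk⟩ := coreMatching_adj_iff.1 h
    exact coreRound_mem hk
  deg := coreMatching_deg
  stab {x y z} hy hxy hn hxz hlt := by
    obtain ⟨k, -, hk⟩ := exists_round_of_adj hxz
    obtain ⟨hx, -, hxu, -⟩ := compatible_two_iff.1 hk.1
    have hn' (j : ℕ) : ¬ (coreRound S P j).Adj x y := fun h => hn (coreRound_le j h)
    have hfull : IsFull (coreRound S P k) y := by
      by_contra hyf
      exact lt_asymm hlt (hk.2.2 y (compatible_two_iff.2 ⟨hx, hy, hxu, hyf, hxy, hn' k⟩)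
        (by rintro rfl; exact lt_irrefl _ hlt))
    refine ⟨hfull.mono (coreRound_le k), fun w hw => ?_⟩
    have hwk : (coreRound S P k).Adj y w := by
      obtain ⟨a, b, hab, ha, hb⟩ := hfull
      rcases coreMatching_deg (coreRound_le k ha) (coreRound_le k hb) hw with h | h | h
      exacts [absurd h hab, h ▸ ha, h ▸ hb]
    obtain ⟨j, hj, hja⟩ := exists_round_of_adj hw
    have hjk : j ≤ k := by
      by_contra! h
      exact hj (coreRound_mono h.le hwk)
    obtain ⟨-, -, hyu, -⟩ := compatible_two_iff.1 hja.1
    rw [dist_comm x y]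
    refine (hja.2.2 x (compatible_two_iff.2 ⟨hy, hx, hyu,
      fun h => hxu (h.mono (coreRound_mono hjk)), hxy.symm, fun h => hn' j h.symm⟩) ?_).le
    rintro rfl
    exact hn hw.symm

/-- Only finitely many pairs can ever be linked, so the union over all rounds is reached after
finitely many rounds, and a further round adds nothing. -/
theorem coreStep_coreMatching (hP : P.Finite) :
    coreStep S P (fun _ => 2) (coreMatching S P fun _ => 2) = coreMatching S P fun _ => 2 := by
  have : ∃ K, coreMatching S P (fun _ => 2) = coreRound S P K := by
    have hf : ∀ p ∈ P ×ˢ P, ∃ k, (coreMatching S P fun _ => 2).Adj p.1 p.2 →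
        (coreRound S P k).Adj p.1 p.2 := fun p _ => by
      by_cases h : (coreMatching S P fun _ => 2).Adj p.1 p.2
      · obtain ⟨k, hk⟩ := coreMatching_adj_iff.1 h
        exact ⟨k, fun _ => hk⟩
      · exact ⟨0, fun h' => absurd h' h⟩
    choose! f hf using hf
    obtain ⟨K, hK⟩ := ((hP.prod hP).image f).bddAbove
    refine ⟨K, le_antisymm (fun x y h => ?_) (coreRound_le K)⟩
    have hxy : (x, y) ∈ P ×ˢ P :=
      ⟨isPartialStable_coreMatching.mem h, isPartialStable_coreMatching.mem h.symm⟩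
    exact coreRound_mono (hK ⟨_, hxy, rfl⟩) (hf _ hxy h)
  obtain ⟨K, hK⟩ := this
  refine le_antisymm ?_ fun x y h => .inl h
  conv_lhs => rw [hK, ← coreRound_succ]
  exact coreRound_le _

theorem not_arrow_arrow_coreMatching (hP : P.Finite) {x y : ℝ}
    (h1 : Arrow S P (fun _ => 2) (coreMatching S P fun _ => 2) x y) :
    ¬ Arrow S P (fun _ => 2) (coreMatching S P fun _ => 2) y x := fun h2 => by
  have : (coreStep S P (fun _ => 2) (coreMatching S P fun _ => 2)).Adj x y := .inr ⟨h1, h2⟩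
  rw [coreStep_coreMatching hP] at this
  exact h1.1.2.2.2 this

/-- The edges drawn by the core algorithm in `S` belong to every partially stable graph on a larger
point set in which no further edges are drawn. -/
theorem coreMatching_le {P' : Set ℝ} {H : SimpleGraph ℝ} (hPP : P ⊆ P') (hPS : P' ∩ S ⊆ P)
    (hH : IsPartialStable P' H)
    (hfin : ∀ x y, Arrow S P' (fun _ => 2) H x y → ¬ Arrow S P' (fun _ => 2) H y x) :
    coreMatching S P (fun _ => 2) ≤ H := by
  suffices h : ∀ k, coreRound S P k ≤ H by
    intro x y hxy
    obtain ⟨k, hk⟩ := coreMatching_adj_iff.1 hxy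
    exact h k hk
  intro k
  induction k with
  | zero => simp [coreRound_zero]
  | succ k ih =>
    rw [coreRound_succ]
    rintro x y (hxy | ⟨h1, h2⟩)
    · exact ih hxy
    by_contra hn
    set G := coreRound S P k
    -- A competitor of `y` inside `S` loses by the arrow in `P`; one outside `S` is at least as far
    -- away as `Sᶜ`, hence farther than `y`.
    have key : ∀ {x y z : ℝ}, Arrow S P (fun _ => 2) G x y → z ∈ P' → x ≠ z → ¬ G.Adj x z →
        z ≠ y → (z ∈ S → ¬ IsFull G z) → dist x y < dist x z := by
      intro x y z h hz hxz hn hzy hS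
      by_cases hzS : z ∈ S
      · obtain ⟨hx, -, hxu, -⟩ := compatible_two_iff.1 h.1
        exact h.2.2 z (compatible_two_iff.2 ⟨hx, hPS ⟨hz, hzS⟩, hxu, hS hzS, hxz, hn⟩) hzy
      · exact h.2.1.trans_le (Metric.infDist_le_dist_of_mem hzS)
    have key2 : ∀ {x y z : ℝ}, Arrow S P (fun _ => 2) G x y → H.Adj x z → ¬ H.Adj x y →
        ¬ G.Adj x z → dist x y < dist x z := by
      intro x y z h hz hny hn
      refine key h (hH.mem hz.symm) hz.ne hn (by rintro rfl; exact hny hz) fun _ hzf => ?_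
      exact hn (hH.adj_of_le ih hzf hz.symm).symm
    have key3 : ∀ {x y : ℝ}, Arrow S P (fun _ => 2) G x y → Arrow S P (fun _ => 2) G y x →
        ¬ H.Adj x y → ∀ z, H.Adj x z → G.Adj x z := by
      intro x y h1 h2 hny z hz
      by_contra hnz
      obtain ⟨hx, hy, hxu, hyu, hxy, -⟩ := compatible_two_iff.1 h1.1
      obtain ⟨⟨a, b, hab, ha, hb⟩, hle⟩ := hH.stab (hPP hy) hxy hny hz (key2 h1 hz hny hnz)
      have hny' : ¬ H.Adj y x := fun h => hny h.symm
      have : ∀ a, H.Adj y a → G.Adj y a := fun a ha => by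
        by_contra hna
        have := key2 h2 ha hny' hna
        have := hle a ha
        rw [dist_comm x y] at this
        linarith
      exact hyu ⟨a, b, hab, this a ha, this b hb⟩
    have key4 : ∀ {x y : ℝ}, Arrow S P (fun _ => 2) G x y → Arrow S P (fun _ => 2) G y x →
        ¬ H.Adj x y → Arrow S P' (fun _ => 2) H x y := by
      intro x y h1 h2 hny
      obtain ⟨hx, hy, hxu, hyu, hxy, -⟩ := compatible_two_iff.1 h1.1
      refine ⟨compatible_two_iff.2 ⟨hPP hx, hPP hy, ?_, ?_, hxy, hny⟩, h1.2.1, fun z hz hzy => ?_⟩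
      · rintro ⟨a, b, hab, ha, hb⟩
        exact hxu ⟨a, b, hab, key3 h1 h2 hny a ha, key3 h1 h2 hny b hb⟩
      · rintro ⟨a, b, hab, ha, hb⟩
        have hny' : ¬ H.Adj y x := fun h => hny h.symm
        exact hyu ⟨a, b, hab, key3 h2 h1 hny' a ha, key3 h2 h1 hny' b hb⟩
      · obtain ⟨-, hz, -, hzu, hxz, hnxz⟩ := compatible_two_iff.1 hz
        exact key h1 hz hxz (fun h => hnxz (ih h)) hzy fun _ h => hzu (h.mono ih)
    exact hfin x y (key4 h1 h2 hn) (key4 h2 h1 fun h => hn h.symm)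

theorem nonempty_compl_Icc (a b : ℝ) : (Icc a b)ᶜ.Nonempty :=
  ⟨b + 1, fun h => by linarith [h.2]⟩

/-- Enlarging the interval only moves its complement away, so mutual arrows relative to `S` would
also be mutual arrows relative to the larger interval, where the algorithm has stopped. -/
theorem coreMatching_mono {X : Set ℝ} {a b : ℝ} (hfin : (X ∩ Icc a b).Finite)
    (hS : S ⊆ Icc a b) :
    coreMatching S (X ∩ S) (fun _ => 2) ≤ coreMatching (Icc a b) (X ∩ Icc a b) fun _ => 2 := by
  refine coreMatching_le (inter_subset_inter_right _ hS) (fun x hx => ⟨hx.1.1, hx.2⟩)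
    isPartialStable_coreMatching fun x y h1 h2 => ?_
  have hinf : ∀ z, Metric.infDist z Sᶜ ≤ Metric.infDist z (Icc a b)ᶜ := fun z =>
    Metric.infDist_le_infDist_of_subset (compl_subset_compl.2 hS) (nonempty_compl_Icc a b)
  exact not_arrow_arrow_coreMatching hfin ⟨h1.1, h1.2.1.trans_le (hinf _), h1.2.2⟩
    ⟨h2.1, h2.2.1.trans_le (hinf _), h2.2.2⟩

end Core

/-! ### Stable multi-matchings contain all core matchings. -/

namespace IsStableMultiMatching

variable {X : Set ℝ} {M : SimpleGraph ℝ}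

theorem isFull (hM : IsStableMultiMatching X (fun _ => 2) M) {x : ℝ} (hx : x ∈ X) : IsFull M x := by
  rw [← one_lt_encard_neighborSet_iff, hM.degree_eq x hx]
  norm_num

theorem isPartialStable (hM : IsStableMultiMatching X (fun _ => 2) M) : IsPartialStable X M where
  mem h := (hM.mem_of_adj _ _ h).1
  deg {x a b c} ha hb hc := by
    by_contra! hne
    have h2 := hM.degree_eq x (hM.mem_of_adj _ _ ha).1
    obtain ⟨u, v, huv, he⟩ := Set.encard_eq_two.1 h2
    have ha : a ∈ M.neighborSet x := ha
    have hb : b ∈ M.neighborSet x := hb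
    have hc : c ∈ M.neighborSet x := hc
    rw [he] at ha hb hc
    simp only [mem_insert_iff, mem_singleton_iff] at ha hb hc
    grind
  stab {x y z} hy hxy hn hxz hlt := by
    refine ⟨hM.isFull hy, ?_⟩
    rcases hM.stable x (hM.mem_of_adj _ _ hxz).1 y hy hxy with h | h | h
    · exact absurd h hn
    · exact absurd (h z hxz) (not_le.2 hlt)
    · exact h

theorem coreMatching_le (hM : IsStableMultiMatching X (fun _ => 2) M) (S : Set ℝ) :
    coreMatching S (X ∩ S) (fun _ => 2) ≤ M :=
  _root_.coreMatching_le inter_subset_left subset_rfl hM.isPartialStable fun _ _ h _ =>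
    (compatible_two_iff.1 h.1).2.2.1 (hM.isFull (compatible_two_iff.1 h.1).1)

end IsStableMultiMatching

/-! ### Bridging short gaps in a core matching. -/

/-- No point of `P` is equidistant from two different points of `P`. -/
def IsoscelesFree (P : Set ℝ) : Prop :=
  ∀ x ∈ P, ∀ y ∈ P, ∀ z ∈ P, y ≠ z → dist x y ≠ dist x z

theorem le_infDist_compl_Icc {a b x d : ℝ} (h1 : d ≤ x - a) (h2 : d ≤ b - x) :
    d ≤ Metric.infDist x (Icc a b)ᶜ := by
  refine (Metric.le_infDist (nonempty_compl_Icc a b)).2 fun y hy => ?_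
  rw [Real.dist_eq]
  by_contra! h
  rw [abs_lt] at h
  exact hy ⟨by linarith, by linarith⟩

section Bridge

variable {P : Set ℝ} {a b : ℝ}

/-- In the core matching, a gap with two unused stubs at its ends cannot be shorter than the
stretches free of unused stubs on both sides of it. -/
theorem no_unused_gap (hP : P.Finite) (hiso : IsoscelesFree P)
    {G : SimpleGraph ℝ} (hG : G = coreMatching (Icc a b) P fun _ => 2) {l r s t : ℝ} (hrs : r < s)
    (hr : r ∈ P) (hs : s ∈ P) (hru : ¬ IsFull G r) (hsu : ¬ IsFull G s) (hn : ¬ G.Adj r s)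
    (h1 : s - r < r - l) (h2 : s - r < t - s) (hal : a ≤ l) (htb : t ≤ b)
    (hgap : ∀ w ∈ P, ¬ IsFull G w → w ≤ l ∨ (r ≤ w ∧ w ≤ s) ∨ t ≤ w) : False := by
  let T : Set (ℝ × ℝ) := {p | Compatible P (fun _ => 2) G p.1 p.2 ∧ p.1 ∈ Icc r s ∧ p.2 ∈ Icc r s}
  have hT : T.Finite := (hP.prod hP).subset fun p hp => ⟨hp.1.1.1, hp.1.2.1.1⟩
  have hne : T.Nonempty := ⟨(r, s), compatible_two_iff.2 ⟨hr, hs, hru, hsu, hrs.ne, hn⟩,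
    ⟨le_rfl, hrs.le⟩, ⟨hrs.le, le_rfl⟩⟩
  obtain ⟨⟨x, y⟩, ⟨hxy, hx, hy⟩, hmin⟩ := exists_min_image T (fun p => dist p.1 p.2) hT hne
  have hle : ∀ {x y : ℝ}, x ∈ Icc r s → y ∈ Icc r s → dist x y ≤ s - r := fun hx hy => by
    rw [Real.dist_eq, abs_le]
    constructor <;> linarith [hx.1, hx.2, hy.1, hy.2]
  have key : ∀ x y, (x, y) ∈ T → (∀ p ∈ T, dist x y ≤ dist p.1 p.2) →
      Arrow (Icc a b) P (fun _ => 2) G x y := by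
    rintro x y ⟨hxy, hx, hy⟩ hmin
    have hd := hle hx hy
    refine ⟨hxy, lt_of_lt_of_le (b := min (r - l) (t - s)) (lt_min (by linarith) (by linarith))
      (le_infDist_compl_Icc ?_ ?_), fun z hz hzy => ?_⟩
    · linarith [min_le_left (r - l) (t - s), hx.1]
    · linarith [min_le_right (r - l) (t - s), hx.2]
    · obtain ⟨hxP, hzP, -, hzu, -, -⟩ := compatible_two_iff.1 hz
      rcases hgap z hzP hzu with h | h | h
      · rw [dist_of_gt (b := z) (by linarith [hx.1])]
        linarith [hx.1]
      · exact lt_of_le_of_ne (hmin (x, z) ⟨hz, hx, h⟩)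
          (hiso x hxP y hxy.2.1.1 z hzP hzy.symm)
      · rw [dist_of_lt (b := z) (by linarith [hx.2])]
        linarith [hx.2]
  have hyx : (y, x) ∈ T := ⟨⟨hxy.2.1, hxy.1, hxy.2.2.1.symm, fun h => hxy.2.2.2 h.symm⟩, hy, hx⟩
  have a1 := key x y ⟨hxy, hx, hy⟩ hmin
  have a2 := key y x hyx fun p hp => by rw [dist_comm]; exact hmin p hp
  subst hG
  exact not_arrow_arrow_coreMatching hP a1 a2

theorem exists_extremes {G : SimpleGraph ℝ} (hG : IsPartialStable P G) (hP : P.Finite) (x : ℝ) :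
    ∃ l r, G.Reachable x l ∧ G.Reachable x r ∧ ∀ c, G.Reachable x c → l ≤ c ∧ c ≤ r := by
  have hfin : {c | G.Reachable x c}.Finite := by
    refine (hP.insert x).subset fun c hc => ?_
    by_cases h : c = x
    · exact .inl h
    · obtain ⟨p, q, hp, hq, hpq, -⟩ := exists_boundary_adj hc.symm (A := {c}) rfl (Ne.symm h)
      obtain rfl : p = c := hp
      exact .inr (hG.mem hpq)
  obtain ⟨l, hl, hl'⟩ := exists_min_image _ id hfin ⟨x, .refl x⟩
  obtain ⟨r, hr, hr'⟩ := exists_max_image _ id hfin ⟨x, .refl x⟩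
  exact ⟨l, r, hl, hr, fun c hc => ⟨hl' c hc, hr' c hc⟩⟩

theorem mem_of_reachable_of_ne {G : SimpleGraph ℝ} (hG : IsPartialStable P G) {x y : ℝ}
    (h : G.Reachable x y) (hne : x ≠ y) : x ∈ P := by
  obtain ⟨p, q, hp, -, hpq, -⟩ := exists_boundary_adj h (A := {x}) rfl (Ne.symm hne)
  obtain rfl : p = x := hp
  exact hG.mem hpq

/-- If two pieces of components of the core matching are separated by a gap that is not longer than
either of them, then a single component reaches from the start of the first to the end of the
second. -/
theorem exists_bridge (hP : P.Finite) (hPab : P ⊆ Icc a b) (hiso : IsoscelesFree P)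
    {G : SimpleGraph ℝ} (hG : G = coreMatching (Icc a b) P fun _ => 2) {x y u v : ℝ}
    (hxy : G.Reachable x y) (huv : G.Reachable u v) (h1 : u - y ≤ y - x) (h2 : u - y ≤ v - u) :
    ∃ x' v', x' ≤ x ∧ v ≤ v' ∧ G.Reachable x' v' := by
  have hst : IsPartialStable P G := hG ▸ isPartialStable_coreMatching
  obtain ⟨l1, r1, hl1, hr1, hx⟩ := exists_extremes hst hP x
  obtain ⟨l2, r2, hl2, hr2, hu⟩ := exists_extremes hst hP u
  by_cases hxu : G.Reachable x u
  · exact ⟨x, v, le_rfl, le_rfl, hxu.trans huv⟩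
  rcases le_or_gt v r1 with hv | hv
  · exact ⟨x, r1, le_rfl, hv, hr1⟩
  rcases le_or_gt l2 x with hl | hl
  · exact ⟨l2, v, hl, le_rfl, hl2.symm.trans huv⟩
  have hy1 := (hx y hxy).2
  have hx1 := (hx x (.refl x)).1
  have hu2 := (hu u (.refl u)).1
  have hv2 := (hu v huv).2
  -- Overlapping ranges would now interlace, which merges the two components.
  rcases le_or_gt l2 r1 with hlr | hlr
  · exact absurd (hl1.trans ((hst.reachable_of_alternating (hx1.trans hl.le) hlr (hv.le.trans hv2)
      (hl1.symm.trans hr1) (hl2.symm.trans hr2)).trans hl2.symm)) hxu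
  exfalso
  have hlt1 : l1 < r1 := by linarith
  have hlt2 : l2 < r2 := by linarith
  have hr1P := mem_of_reachable_of_ne hst (hr1.symm.trans hl1) hlt1.ne'
  have hl1P := mem_of_reachable_of_ne hst (hl1.symm.trans hr1) hlt1.ne
  have hr2P := mem_of_reachable_of_ne hst (hr2.symm.trans hl2) hlt2.ne'
  have hl2P := mem_of_reachable_of_ne hst (hl2.symm.trans hr2) hlt2.ne
  have hgap1 : l2 - r1 < r1 - l1 := by
    refine lt_of_le_of_ne (by linarith) fun h => ?_
    refine hiso r1 hr1P l1 hl1P l2 hl2P (by linarith) ?_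
    rw [dist_of_gt hlt1, dist_of_lt hlr, h]
  have hgap2 : l2 - r1 < r2 - l2 := by
    refine lt_of_le_of_ne (by linarith) fun h => ?_
    refine hiso l2 hl2P r1 hr1P r2 hr2P (by linarith) ?_
    rw [dist_of_gt hlr, dist_of_lt hlt2, h]
  have hn : ¬ G.Adj r1 l2 := fun h => hxu (hr1.trans (h.reachable.trans hl2.symm))
  have ha1 : IsFull G r1 → G.Adj l1 r1 := hst.adj_of_isFull_right hP (hl1.symm.trans hr1) hlt1
    (fun c hc => (hx c (hl1.trans hc)).1) (fun c hc => (hx c (hl1.trans hc)).2)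
  have ha2 : IsFull G l2 → G.Adj l2 r2 := hst.adj_of_isFull_left hP (hl2.symm.trans hr2) hlt2
    (fun c hc => (hu c (hl2.trans hc)).1) (fun c hc => (hu c (hl2.trans hc)).2)
  by_cases hf1 : IsFull G r1
  · obtain ⟨hf2, hle⟩ := hst.stab hl2P hlr.ne hn (ha1 hf1).symm
      (by rw [dist_of_lt hlr, dist_of_gt hlt1]; exact hgap1)
    have := hle r2 (ha2 hf2)
    rw [dist_of_lt hlr, dist_of_lt hlt2] at this
    linarith
  by_cases hf2 : IsFull G l2
  · exact hf1 (hst.stab hr1P hlr.ne' (fun h => hn h.symm) (ha2 hf2)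
      (by rw [dist_of_gt hlr, dist_of_lt hlt2]; exact hgap2)).1
  refine no_unused_gap hP hiso hG hlr hr1P hl2P hf1 hf2 hn hgap1 hgap2 (hPab hl1P).1 (hPab hr2P).2
    fun w hw hwu => ?_
  by_contra! hcon
  obtain ⟨c1, c2, c3⟩ := hcon
  rcases lt_or_ge w r1 with h | h
  · exact hwu (hst.isFull_of_between (hl1.symm.trans hr1) hw c1 h)
  · exact hwu (hst.isFull_of_between (hl2.symm.trans hr2) hw (c2 h) c3)

end Bridge

/-! ### Deterministic renormalization from scale `L` to `7 * L`. -/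

theorem IsoscelesFree.mono {P Q : Set ℝ} (h : IsoscelesFree Q) (hPQ : P ⊆ Q) : IsoscelesFree P :=
  fun x hx y hy z hz => h x (hPQ hx) y (hPQ hy) z (hPQ hz)

theorem IsGood.exists_reachable {X : Set ℝ} {a b c d : ℝ} (h : IsGood X a b)
    (hfin : (X ∩ Icc c d).Finite) (hca : c ≤ a) (hbd : b ≤ d) :
    ∃ x y, x ∈ Icc a (3 / 4 * a + 1 / 4 * b) ∧ y ∈ Icc (1 / 4 * a + 3 / 4 * b) b ∧
      (coreMatching (Icc c d) (X ∩ Icc c d) fun _ => 2).Reachable x y := by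
  obtain ⟨x, -, y, -, hx, hy, hxy⟩ := h
  exact ⟨x, y, hx, hy, hxy.mono (coreMatching_mono hfin (Icc_subset_Icc hca hbd))⟩

/-- Renormalization: an interval of length `7 L` is good if among the thirteen intervals of length
`L` starting at the multiples of `L / 2` no two adjacent but disjoint ones are both bad. -/
theorem isGood_of_isGood_or {X : Set ℝ} {L : ℝ} (hL : 0 < L) (hfin : (X ∩ Icc 0 (7 * L)).Finite)
    (hiso : IsoscelesFree X)
    (h : ∀ i : ℕ, i ≤ 10 → IsGood X (i * (L / 2)) (i * (L / 2) + L) ∨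
      IsGood X ((i + 2 : ℕ) * (L / 2)) ((i + 2 : ℕ) * (L / 2) + L)) :
    IsGood X 0 (7 * L) := by
  obtain ⟨gd, hgd⟩ : ∃ gd : ℕ → Prop, ∀ i, gd i = IsGood X (i * (L / 2)) (i * (L / 2) + L) :=
    ⟨_, fun _ => rfl⟩
  simp only [← hgd] at h
  obtain ⟨G, hG⟩ : ∃ G, G = coreMatching (Icc 0 (7 * L)) (X ∩ Icc 0 (7 * L)) fun _ => 2 := ⟨_, rfl⟩
  have hiso' : IsoscelesFree (X ∩ Icc 0 (7 * L)) := hiso.mono inter_subset_left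
  have hst : IsPartialStable (X ∩ Icc 0 (7 * L)) G := hG ▸ isPartialStable_coreMatching
  have hone : ∀ i : ℕ, i ≤ 12 → gd i → ∃ x y, i * (L / 2) ≤ x ∧ x ≤ i * (L / 2) + L / 4 ∧
      i * (L / 2) + 3 / 4 * L ≤ y ∧ y ≤ i * (L / 2) + L ∧ G.Reachable x y := by
    intro i hi hg
    have hi' : (i : ℝ) ≤ 12 := by exact_mod_cast hi
    rw [hgd] at hg
    obtain ⟨x, y, hx, hy, hxy⟩ := hg.exists_reachable hfin (by positivity) (by nlinarith)
    exact ⟨x, y, hx.1, by linarith [hx.2], by linarith [hy.1], hy.2, hG ▸ hxy⟩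
  -- The last quarter of one interval and the first quarter of the next share only the point `j * (L
  -- / 2) + 3 / 4 * L`, so the pieces leave no gap. The joined piece has length at least `L` and can
  -- itself bridge gaps up to `L`.
  have htwo : ∀ j : ℕ, j ≤ 11 → gd j → gd (j + 1) → ∃ u v, u ≤ j * (L / 2) + L / 4 ∧
      j * (L / 2) + 5 / 4 * L ≤ v ∧ G.Reachable u v := by
    intro j hj h1 h2
    obtain ⟨x, y, -, hx, hy, -, hxy⟩ := hone j (by omega) h1
    obtain ⟨u, v, -, hu, hv, -, huv⟩ := hone (j + 1) (by omega) h2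
    push_cast at hu hv
    obtain ⟨x', v', hx', hv', hr⟩ :=
      exists_bridge hfin inter_subset_right hiso' hG hxy huv (by linarith) (by linarith)
    exact ⟨x', v', by linarith, by linarith, hr⟩
  -- The bound `7 / 4 * L` is the end of the first quarter of `[0, 7 * L]`.
  let H : ℕ → Prop := fun j => gd j ∧ gd (j + 1) ∧ ∃ x y, x ≤ 7 / 4 * L ∧ x ≤ j * (L / 2) + L / 4 ∧
      j * (L / 2) + 5 / 4 * L ≤ y ∧ G.Reachable x y
  -- Going from `j` to at most `j + 4` shifts the start by at most `2 * L`, so the gap after a piece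
  -- reaching `j * (L / 2) + 5 / 4 * L` is at most `L`.
  have hmove : ∀ j j' : ℕ, H j → j < j' → j' ≤ j + 4 → j' ≤ 11 → gd j' → gd (j' + 1) → H j' := by
    rintro j j' ⟨-, -, x, y, hx1, hx2, hy, hxy⟩ hjj hjj' hj' h1 h2
    obtain ⟨u, v, hu, hv, huv⟩ := htwo j' hj' h1 h2
    have e1 : (j : ℝ) ≤ j' := by exact_mod_cast hjj.le
    have e2 : (j' : ℝ) ≤ j + 4 := by exact_mod_cast hjj'
    have e3 : (j : ℝ) * (L / 2) ≤ j' * (L / 2) := by gcongr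
    have e4 : (j' : ℝ) * (L / 2) ≤ (j + 4) * (L / 2) := by gcongr
    obtain ⟨x', v', hx', hv', hr⟩ :=
      exists_bridge hfin inter_subset_right hiso' hG hxy huv (by linarith) (by linarith)
    exact ⟨h1, h2, x', v', by linarith, by linarith, by linarith, hr⟩
  -- The next good consecutive pair starts at `j + 1`, `j + 3` or `j + 4`, because indices two apart
  -- are never both bad. For `j ≤ 7` all indices involved are at most `12`.
  have hstep : ∀ j : ℕ, j ≤ 7 → H j → ∃ j', j < j' ∧ j' ≤ 11 ∧ H j' := by
    intro j hj hH
    have g1 := hH.2.1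
    by_cases g2 : gd (j + 2)
    · exact ⟨j + 1, by omega, by omega, hmove j _ hH (by omega) (by omega) (by omega) g1 g2⟩
    have g4 := (h (j + 2) (by omega)).resolve_left g2
    by_cases g3 : gd (j + 3)
    · exact ⟨j + 3, by omega, by omega, hmove j _ hH (by omega) (by omega) (by omega) g3 g4⟩
    have g5 := (h (j + 3) (by omega)).resolve_left g3
    exact ⟨j + 4, by omega, by omega, hmove j _ hH (by omega) (by omega) (by omega) g4 g5⟩
  have hstart : ∃ j, j ≤ 3 ∧ H j := by
    have hs : ∃ j, j ≤ 3 ∧ gd j ∧ gd (j + 1) := by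
      by_cases g1 : gd 1
      · rcases h 0 (by omega) with g0 | g2
        exacts [⟨0, by omega, g0, g1⟩, ⟨1, by omega, g1, g2⟩]
      · have g3 := (h 1 (by omega)).resolve_left g1
        rcases h 2 (by omega) with g2 | g4
        exacts [⟨2, by omega, g2, g3⟩, ⟨3, by omega, g3, g4⟩]
    obtain ⟨j, hj, h1, h2⟩ := hs
    obtain ⟨u, v, hu, hv, huv⟩ := htwo j (by omega) h1 h2
    have e1 : (j : ℝ) ≤ 3 := by exact_mod_cast hj
    have e2 : (j : ℝ) * (L / 2) ≤ 3 * (L / 2) := by gcongr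
    exact ⟨j, hj, h1, h2, u, v, by linarith, hu, hv, huv⟩
  have hend : ∀ n : ℕ, ∃ j, j ≤ 11 ∧ (n ≤ j ∨ 8 ≤ j) ∧ H j := by
    intro n
    induction n with
    | zero =>
      obtain ⟨j, hj, hH⟩ := hstart
      exact ⟨j, by omega, by omega, hH⟩
    | succ n ih =>
      obtain ⟨j, hj, hn, hH⟩ := ih
      by_cases h8 : 8 ≤ j
      · exact ⟨j, hj, .inr h8, hH⟩
      · obtain ⟨j', h1, h2, h3⟩ := hstep j (by omega) hH
        exact ⟨j', h2, by omega, h3⟩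
  -- At `j = 8` the piece reaches `4 * L + 5 / 4 * L`, exactly the start of the last quarter of `[0,
  -- 7 * L]`.
  obtain ⟨j, -, hj, -, -, x, y, hx, -, hy, hxy⟩ := hend 8
  have e1 : (8 : ℝ) ≤ j := by exact_mod_cast (by omega : 8 ≤ j)
  have e2 : (8 : ℝ) * (L / 2) ≤ j * (L / 2) := by gcongr
  have hxP := mem_of_reachable_of_ne hst hxy (by linarith)
  have hyP := mem_of_reachable_of_ne hst hxy.symm (by linarith)
  exact ⟨x, hxP, y, hyP, ⟨hxP.2.1, by linarith⟩, ⟨by linarith, hyP.2.2⟩, hG ▸ hxy⟩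

/-! ### The limit matching, uniqueness and the infinite component. -/

/-- The limit of the core matchings in the intervals `[-n, n]`. -/
def limitMatching (X : Set ℝ) : SimpleGraph ℝ :=
  ⨆ n : ℕ, coreMatching (Icc (-n : ℝ) n) (X ∩ Icc (-n : ℝ) n) fun _ => 2

theorem monotone_coreMatching_Icc {X : Set ℝ} (hfin : ∀ a b, (X ∩ Icc a b).Finite) :
    Monotone fun n : ℕ => coreMatching (Icc (-n : ℝ) n) (X ∩ Icc (-n : ℝ) n) fun _ => 2 := by
  intro m n hmn
  have : (m : ℝ) ≤ n := by exact_mod_cast hmn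
  exact coreMatching_mono (hfin _ _) (Icc_subset_Icc (by linarith) this)

theorem coreMatching_Icc_le_limitMatching {X : Set ℝ} (hfin : ∀ a b, (X ∩ Icc a b).Finite)
    (a b : ℝ) : coreMatching (Icc a b) (X ∩ Icc a b) (fun _ => 2) ≤ limitMatching X := by
  obtain ⟨n, hn⟩ := exists_nat_ge (max (-a) b)
  refine le_trans (coreMatching_mono (hfin (-n) n) (Icc_subset_Icc ?_ ?_))
    (le_iSup (fun n : ℕ => coreMatching (Icc (-n : ℝ) n) (X ∩ Icc (-n : ℝ) n) fun _ => 2) n)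
  · linarith [le_max_left (-a) b]
  · linarith [le_max_right (-a) b]

theorem exists_adj_of_limitMatching {X : Set ℝ} {x y : ℝ} (h : (limitMatching X).Adj x y) :
    ∃ n : ℕ, (coreMatching (Icc (-n : ℝ) n) (X ∩ Icc (-n : ℝ) n) fun _ => 2).Adj x y := by
  simpa [limitMatching] using h

theorem isStableMultiMatching_limitMatching {X : Set ℝ} (hfin : ∀ a b, (X ∩ Icc a b).Finite)
    (hfull : ∀ x ∈ X, IsFull (limitMatching X) x) :
    IsStableMultiMatching X (fun _ => 2) (limitMatching X) where
  mem_of_adj x y h := by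
    obtain ⟨n, hn⟩ := exists_adj_of_limitMatching h
    exact ⟨(isPartialStable_coreMatching.mem hn).1, (isPartialStable_coreMatching.mem hn.symm).1⟩
  degree_eq x hx := by
    obtain ⟨a, b, hab, ha, hb⟩ := hfull x hx
    rw [show ((2 : ℕ) : ℕ∞) = 2 from rfl, Set.encard_eq_two]
    refine ⟨a, b, hab, Set.ext fun c => ⟨fun hc => ?_, ?_⟩⟩
    · obtain ⟨i, hi⟩ := exists_adj_of_limitMatching ha
      obtain ⟨j, hj⟩ := exists_adj_of_limitMatching hb
      obtain ⟨k, hk⟩ := exists_adj_of_limitMatching hc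
      have hm := monotone_coreMatching_Icc hfin
      rcases coreMatching_deg (hm (le_max_left i (max j k)) hi)
        (hm ((le_max_left j k).trans (le_max_right i _)) hj)
        (hm ((le_max_right j k).trans (le_max_right i _)) hk) with h | h | h
      exacts [absurd h hab, .inl h.symm, .inr h.symm]
    · rintro (rfl | rfl)
      exacts [ha, hb]
  stable x hx y hy hxy := by
    by_contra! hcon
    obtain ⟨hn, ⟨z, hz, hxz⟩, ⟨w, hw, hyw⟩⟩ := hcon
    obtain ⟨i, hi⟩ := exists_adj_of_limitMatching hz
    obtain ⟨j, hj⟩ := exists_adj_of_limitMatching hw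
    have hm := monotone_coreMatching_Icc hfin
    have hi := hm (le_max_left i j) hi
    have hj := hm (le_max_right i j) hj
    refine not_le.2 hyw ((isPartialStable_coreMatching.stab (isPartialStable_coreMatching.mem hj)
      hxy (fun h => hn ?_) hi hxz).2 w hj)
    exact coreMatching_Icc_le_limitMatching hfin _ _ h

/-- If the intervals at the multiples of half their length are good at all large scales, then the
stable multi-matching is unique and has an infinite component. -/
theorem existsUnique_of_eventually_isGood {X : Set ℝ} (hfin : ∀ a b, (X ∩ Icc a b).Finite)
    {L : ℝ} (hL : 0 < L)
    (h : ∀ᶠ n : ℕ in Filter.atTop, ∀ i : ℤ, -1 ≤ i → i ≤ 9 →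
      IsGood X (i * (7 ^ n * L / 2)) (i * (7 ^ n * L / 2) + 7 ^ n * L)) :
    (∃! G : SimpleGraph ℝ, IsStableMultiMatching X (fun _ => 2) G) ∧
      ∀ G : SimpleGraph ℝ, IsStableMultiMatching X (fun _ => 2) G → HasInfiniteComponent G := by
  obtain ⟨N, hN⟩ := Filter.eventually_atTop.1 h
  have hlarge : ∀ C : ℝ, ∃ n, N ≤ n ∧ C < 7 ^ n * L := by
    intro C
    have h1 : Filter.Tendsto (fun n : ℕ => (7 : ℝ) ^ n * L) Filter.atTop Filter.atTop :=
      (tendsto_pow_atTop_atTop_of_one_lt (by norm_num)).atTop_mul_const hL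
    obtain ⟨n, h1, h2⟩ := ((h1.eventually_gt_atTop C).and (Filter.eventually_ge_atTop N)).exists
    exact ⟨n, h2, h1⟩
  have hfull : ∀ x ∈ X, IsFull (limitMatching X) x := by
    intro x hx
    -- The index `-1` gives the interval centred at the origin; its long component reaches past a
    -- quarter of the length on both sides, hence around `x`.
    obtain ⟨n, hn, hlt⟩ := hlarge (4 * |x|)
    obtain ⟨u, -, v, -, hu, hv, huv⟩ := hN n hn (-1) (by norm_num) (by norm_num)
    set ℓ : ℝ := 7 ^ n * L
    push_cast at hu hv huv
    have hx1 := neg_abs_le x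
    have hx2 := le_abs_self x
    exact (isPartialStable_coreMatching.isFull_of_between huv ⟨hx, by linarith, by linarith⟩
      (by linarith [hu.2]) (by linarith [hv.1])).mono (coreMatching_Icc_le_limitMatching hfin _ _)
  have huniq : ∀ M, IsStableMultiMatching X (fun _ => 2) M → M = limitMatching X := by
    intro M hM
    have hle : limitMatching X ≤ M := iSup_le fun n => hM.coreMatching_le _
    refine le_antisymm (fun x y hxy => ?_) hle
    exact hM.isPartialStable.adj_of_le hle (hfull x (hM.mem_of_adj _ _ hxy).1) hxy
  refine ⟨⟨_, isStableMultiMatching_limitMatching hfin hfull, huniq⟩, fun M hM => ?_⟩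
  have hst := hM.isPartialStable
  have hgood : ∀ n : ℕ, N ≤ n → ∀ i : ℤ, -1 ≤ i → i ≤ 9 → ∃ x y : ℝ, M.Reachable x y ∧
      i * (7 ^ n * L / 2) ≤ x ∧ x ≤ i * (7 ^ n * L / 2) + 7 ^ n * L / 4 ∧
      i * (7 ^ n * L / 2) + 3 / 4 * (7 ^ n * L) ≤ y ∧ y ≤ i * (7 ^ n * L / 2) + 7 ^ n * L := by
    intro n hn i h1 h2
    obtain ⟨u, -, v, -, hu, hv, huv⟩ := hN n hn i h1 h2
    exact ⟨u, v, huv.mono (hM.coreMatching_le _), hu.1, by linarith [hu.2], by linarith [hv.1],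
      hv.2⟩
  choose! x y hxy hx1 hx2 hy1 hy2 using hgood
  have hpos : ∀ n : ℕ, (0 : ℝ) < 7 ^ n * L := fun n => by positivity
  -- The long components of consecutive half-overlapping intervals interlace, so those with indices
  -- `1` to `9` are one component.
  have hchain : ∀ n : ℕ, N ≤ n → ∀ k : ℕ, k ≤ 8 → M.Reachable (x n 1) (x n (k + 1)) := by
    intro n hn k hk
    induction k with
    | zero => exact .refl _
    | succ k ih =>
      have ih := ih (by omega)
      refine ih.trans ?_
      have a1 := hxy n hn (k + 1) (by omega) (by omega)
      have a2 := hx2 n hn (k + 1) (by omega) (by omega)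
      have a3 := hy1 n hn (k + 1) (by omega) (by omega)
      have a4 := hy2 n hn (k + 1) (by omega) (by omega)
      have b1 := hxy n hn ((k + 1 : ℕ) + 1) (by omega) (by omega)
      have b2 := hx1 n hn ((k + 1 : ℕ) + 1) (by omega) (by omega)
      have b3 := hx2 n hn ((k + 1 : ℕ) + 1) (by omega) (by omega)
      have b4 := hy1 n hn ((k + 1 : ℕ) + 1) (by omega) (by omega)
      have := hpos n
      set ℓ : ℝ := 7 ^ n * L
      push_cast at a2 a3 a4 b2 b3 b4
      exact hst.reachable_of_alternating (by push_cast; linarith) (by push_cast; linarith)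
        (by push_cast; linarith) a1 b1
  -- Index `9` is what is needed to meet the next scale: the chain reaches `21 / 4` times the
  -- length, which is the end of the first quarter of the interval with index `1` at scale `n + 1`.
  have hscale : ∀ n : ℕ, N ≤ n → M.Reachable (x n 1) (x (n + 1) 1) := by
    intro n hn
    have a1 := (hchain n hn 8 le_rfl).trans (hxy n hn 9 (by norm_num) (by norm_num))
    have a2 := hx2 n hn 1 (by norm_num) (by norm_num)
    have a3 := hy1 n hn 9 (by norm_num) (by norm_num)
    have a4 := hy2 n hn 9 (by norm_num) (by norm_num)
    have b1 := hxy (n + 1) (by omega) 1 (by norm_num) (by norm_num)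
    have b2 := hx1 (n + 1) (by omega) 1 (by norm_num) (by norm_num)
    have b3 := hx2 (n + 1) (by omega) 1 (by norm_num) (by norm_num)
    have b4 := hy1 (n + 1) (by omega) 1 (by norm_num) (by norm_num)
    have := hpos n
    have e : (7 : ℝ) ^ (n + 1) * L = 7 * (7 ^ n * L) := by ring
    rw [e] at b2 b3 b4
    set ℓ : ℝ := 7 ^ n * L
    push_cast at a2 a3 a4 b2 b3 b4
    exact hst.reachable_of_alternating (by linarith) (by linarith) (by linarith) a1 b1
  have hall : ∀ n, N ≤ n → M.Reachable (x N 1) (x n 1) := by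
    intro n hn
    induction n, hn using Nat.le_induction with
    | base => exact .refl _
    | succ n hn ih => exact ih.trans (hscale n hn)
  refine ⟨M.connectedComponentMk (x N 1), fun hf => ?_⟩
  obtain ⟨C, hC⟩ := hf.bddAbove
  obtain ⟨n, hn, hlt⟩ := hlarge (2 * C)
  have h1 : x n 1 ≤ C := hC (by
    rw [SimpleGraph.ConnectedComponent.mem_supp_iff, SimpleGraph.ConnectedComponent.eq]
    exact (hall n hn).symm)
  have h2 := hx1 n hn 1 (by norm_num) (by norm_num)
  push_cast at h2
  linarith

/-! ### Translation equivariance of the core algorithm. -/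

section Translation

variable (c : ℝ)

theorem isFull_comap_add {G : SimpleGraph ℝ} {x : ℝ} :
    IsFull (G.comap (· + c)) x ↔ IsFull G (x + c) := by
  constructor
  · rintro ⟨a, b, hab, ha, hb⟩
    exact ⟨a + c, b + c, by simpa using hab, ha, hb⟩
  · rintro ⟨a, b, hab, ha, hb⟩
    exact ⟨a - c, b - c, by simpa using hab, by simpa using ha, by simpa using hb⟩

theorem infDist_compl_preimage_add (S : Set ℝ) (x : ℝ) :
    Metric.infDist x ((· + c) ⁻¹' S)ᶜ = Metric.infDist (x + c) Sᶜ := by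
  rw [← preimage_compl]
  conv_rhs => rw [← image_preimage_eq Sᶜ (add_right_surjective c)]
  exact (Metric.infDist_image (isometry_add_right c)).symm

theorem arrow_preimage_add {S P : Set ℝ} {G : SimpleGraph ℝ} {x y : ℝ} :
    Arrow ((· + c) ⁻¹' S) ((· + c) ⁻¹' P) (fun _ => 2) (G.comap (· + c)) x y ↔
      Arrow S P (fun _ => 2) G (x + c) (y + c) := by
  have hc : ∀ x y, Compatible ((· + c) ⁻¹' P) (fun _ => 2) (G.comap (· + c)) x y ↔
      Compatible P (fun _ => 2) G (x + c) (y + c) := fun x y => by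
    rw [compatible_two_iff, compatible_two_iff, isFull_comap_add, isFull_comap_add]
    simp
  rw [Arrow, Arrow, hc, infDist_compl_preimage_add, dist_add_right]
  refine and_congr_right fun _ => and_congr_right fun _ => ⟨fun h z hz hzy => ?_,
    fun h z hz hzy => ?_⟩
  · have := h (z - c) ((hc _ _).2 (by simpa using hz)) (fun e => hzy (by rw [← e]; ring))
    rwa [← dist_add_right x (z - c) c, sub_add_cancel] at this
  · have := h (z + c) ((hc _ _).1 hz) (by simpa using hzy)
    rwa [dist_add_right] at this

theorem coreRound_preimage_add (S P : Set ℝ) (k : ℕ) :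
    coreRound ((· + c) ⁻¹' S) ((· + c) ⁻¹' P) k = (coreRound S P k).comap (· + c) := by
  induction k with
  | zero => rfl
  | succ k ih =>
    rw [coreRound_succ, coreRound_succ, ih]
    ext x y
    exact or_congr Iff.rfl (and_congr (arrow_preimage_add c) (arrow_preimage_add c))

theorem coreMatching_preimage_add (S P : Set ℝ) :
    coreMatching ((· + c) ⁻¹' S) ((· + c) ⁻¹' P) (fun _ => 2) =
      (coreMatching S P fun _ => 2).comap (· + c) := by
  ext x y
  simp [coreMatching_adj_iff, coreRound_preimage_add]

theorem isGood_preimage_add {X : Set ℝ} {a b : ℝ} :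
    IsGood ((· + c) ⁻¹' X) a b ↔ IsGood X (a + c) (b + c) := by
  have hS : Icc a b = (· + c) ⁻¹' Icc (a + c) (b + c) := by ext; simp
  have hreach : ∀ (G : SimpleGraph ℝ) x y,
      (G.comap (· + c)).Reachable x y ↔ G.Reachable (x + c) (y + c) := fun G x y =>
    (SimpleGraph.Iso.reachable_iff
      (φ := (⟨Equiv.addRight c, Iff.rfl⟩ : G.comap (· + c) ≃g G))).symm
  have hmem : ∀ x, x ∈ (· + c) ⁻¹' X ∩ Icc a b ↔ x + c ∈ X ∩ Icc (a + c) (b + c) := fun x => by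
    simp
  have hq1 : ∀ x, x ∈ Icc a (3 / 4 * a + 1 / 4 * b) ↔
      x + c ∈ Icc (a + c) (3 / 4 * (a + c) + 1 / 4 * (b + c)) := fun x => by
    rw [mem_Icc, mem_Icc, add_le_add_iff_right]
    refine and_congr_right fun _ => ⟨fun h => ?_, fun h => ?_⟩ <;> linarith
  have hq2 : ∀ x, x ∈ Icc (1 / 4 * a + 3 / 4 * b) b ↔
      x + c ∈ Icc (1 / 4 * (a + c) + 3 / 4 * (b + c)) (b + c) := fun x => by
    rw [mem_Icc, mem_Icc, add_le_add_iff_right]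
    refine and_congr_left fun _ => ⟨fun h => ?_, fun h => ?_⟩ <;> linarith
  have hG : coreMatching (Icc a b) ((· + c) ⁻¹' X ∩ Icc a b) (fun _ => 2) =
      (coreMatching (Icc (a + c) (b + c)) (X ∩ Icc (a + c) (b + c)) fun _ => 2).comap (· + c) := by
    rw [← coreMatching_preimage_add, preimage_inter, ← hS]
  rw [IsGood, IsGood, hG]
  constructor
  · rintro ⟨x, hx, y, hy, h1, h2, h3⟩
    exact ⟨x + c, (hmem x).1 hx, y + c, (hmem y).1 hy, (hq1 x).1 h1, (hq2 y).1 h2,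
      (hreach _ _ _).1 h3⟩
  · rintro ⟨x, hx, y, hy, h1, h2, h3⟩
    obtain ⟨x, rfl⟩ : ∃ x', x' + c = x := ⟨x - c, by ring⟩
    obtain ⟨y, rfl⟩ : ∃ y', y' + c = y := ⟨y - c, by ring⟩
    exact ⟨x, (hmem x).2 hx, y, (hmem y).2 hy, (hq1 x).2 h1, (hq2 y).2 h2, (hreach _ _ _).2 h3⟩

end Translation

/-! ### Measurability of goodness for finite tuples. -/

theorem exists_cons_of_length_succ {V : Type*} {G : SimpleGraph V} {u v : V} {m : ℕ}
    (p : G.Walk u v) (hp : p.length = m + 1) :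
    ∃ w, G.Adj u w ∧ ∃ q : G.Walk w v, q.length = m := by
  cases p with
  | nil => simp at hp
  | cons h q => exact ⟨_, h, q, by simpa using hp⟩

section Tuples

theorem lt_infDist_compl_Icc_iff {a b x d : ℝ} (hx : x ∈ Icc a b) :
    d < Metric.infDist x (Icc a b)ᶜ ↔ d < x - a ∧ d < b - x := by
  have h1 : Metric.infDist x (Icc a b)ᶜ ≤ x - a := by
    refine le_of_forall_pos_le_add fun ε hε => ?_
    have := Metric.infDist_le_dist_of_mem (x := x) (s := (Icc a b)ᶜ) (y := a - ε)
      (fun h => by linarith [h.1])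
    rw [dist_of_gt (by linarith [hx.1])] at this
    linarith
  have h2 : Metric.infDist x (Icc a b)ᶜ ≤ b - x := by
    refine le_of_forall_pos_le_add fun ε hε => ?_
    have := Metric.infDist_le_dist_of_mem (x := x) (s := (Icc a b)ᶜ) (y := b + ε)
      (fun h => by linarith [h.2])
    rw [dist_of_lt (by linarith [hx.2])] at this
    linarith
  refine ⟨fun h => ⟨h.trans_le h1, h.trans_le h2⟩, fun h => ?_⟩
  exact (lt_min h.1 h.2).trans_le (le_infDist_compl_Icc (min_le_left _ _) (min_le_right _ _))

variable {n : ℕ} {a b : ℝ}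

theorem isFull_iff_of_range {t : Fin n → ℝ} {G : SimpleGraph ℝ}
    (hG : ∀ {x y}, G.Adj x y → y ∈ range t) {x : ℝ} : IsFull G x ↔ ∃ i j, t i ≠ t j ∧ G.Adj x (t i) ∧ G.Adj x (t j) := by
  constructor
  · rintro ⟨u, v, huv, hu, hv⟩
    obtain ⟨i, rfl⟩ := hG hu
    obtain ⟨j, rfl⟩ := hG hv
    exact ⟨i, j, huv, hu, hv⟩
  · rintro ⟨i, j, h⟩
    exact ⟨t i, t j, h⟩

/-- The core matching rounds of a tuple of points. -/
def tupleRound (a b : ℝ) (t : Fin n → ℝ) (k : ℕ) : SimpleGraph ℝ :=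
  coreRound (Icc a b) (range t ∩ Icc a b) k

/-- Every vertex with an edge is an entry of `t`, so quantifiers over points become finite unions
and intersections over indices, and each round is a Boolean combination of comparisons of
coordinates. -/
theorem measurableSet_tupleRound (k : ℕ) (i j : Fin n) :
    MeasurableSet {t : Fin n → ℝ | (tupleRound a b t k).Adj (t i) (t j)} := by
  induction k generalizing i j with
  | zero => simp [tupleRound, coreRound_zero]
  | succ k ih =>
    have hmem : ∀ i : Fin n, MeasurableSet {t : Fin n → ℝ | t i ∈ Icc a b} := fun i =>
      measurable_pi_apply i measurableSet_Icc
    have hne : ∀ i j : Fin n, MeasurableSet {t : Fin n → ℝ | t i ≠ t j} := fun i j =>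
      (measurableSet_eq_fun (measurable_pi_apply i) (measurable_pi_apply j)).compl
    have hfull : ∀ i : Fin n,
        MeasurableSet {t : Fin n → ℝ | IsFull (tupleRound a b t k) (t i)} := by
      intro i
      have : {t : Fin n → ℝ | IsFull (tupleRound a b t k) (t i)} =
          ⋃ u, ⋃ v, {t : Fin n → ℝ | t u ≠ t v} ∩
            ({t | (tupleRound a b t k).Adj (t i) (t u)} ∩
              {t | (tupleRound a b t k).Adj (t i) (t v)}) := by
        ext t
        simp only [mem_iUnion, mem_inter_iff, mem_ofPred_eq]
        exact isFull_iff_of_range fun h => (coreRound_mem h.symm).1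
      rw [this]
      exact .iUnion fun u => .iUnion fun v => (hne u v).inter ((ih i u).inter (ih i v))
    have hcomp : ∀ i j : Fin n, MeasurableSet {t : Fin n → ℝ |
        Compatible (range t ∩ Icc a b) (fun _ => 2) (tupleRound a b t k) (t i) (t j)} := by
      intro i j
      have : {t : Fin n → ℝ |
          Compatible (range t ∩ Icc a b) (fun _ => 2) (tupleRound a b t k) (t i) (t j)} =
          {t | t i ∈ Icc a b} ∩ ({t | t j ∈ Icc a b} ∩
            ({t | IsFull (tupleRound a b t k) (t i)}ᶜ ∩ ({t | IsFull (tupleRound a b t k) (t j)}ᶜ ∩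
              ({t | t i ≠ t j} ∩ {t | (tupleRound a b t k).Adj (t i) (t j)}ᶜ)))) := by
        ext t
        simp [compatible_two_iff]
      rw [this]
      exact (hmem i).inter ((hmem j).inter ((hfull i).compl.inter ((hfull j).compl.inter
        ((hne i j).inter (ih i j).compl))))
    have harrow : ∀ i j : Fin n, MeasurableSet {t : Fin n → ℝ |
        Arrow (Icc a b) (range t ∩ Icc a b) (fun _ => 2) (tupleRound a b t k) (t i) (t j)} := by
      intro i j
      have : {t : Fin n → ℝ |
          Arrow (Icc a b) (range t ∩ Icc a b) (fun _ => 2) (tupleRound a b t k) (t i) (t j)} =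
          {t | Compatible (range t ∩ Icc a b) (fun _ => 2) (tupleRound a b t k) (t i) (t j)} ∩
            ({t | dist (t i) (t j) < t i - a} ∩ ({t | dist (t i) (t j) < b - t i} ∩
              ⋂ m, ({t |
                Compatible (range t ∩ Icc a b) (fun _ => 2) (tupleRound a b t k) (t i) (t m)}ᶜ ∪
                ({t | t m ≠ t j}ᶜ ∪ {t | dist (t i) (t j) < dist (t i) (t m)})))) := by
        ext t
        simp only [mem_inter_iff, mem_ofPred_eq, mem_iInter, mem_union, mem_compl_iff]
        rw [Arrow]
        refine and_congr_right fun hc => ?_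
        rw [lt_infDist_compl_Icc_iff hc.1.1.2, and_assoc]
        refine and_congr_right fun _ => and_congr_right fun _ =>
          ⟨fun h m => ?_, fun h z hz hzj => ?_⟩
        · have := h (t m)
          tauto
        · obtain ⟨m, rfl⟩ := hz.2.1.1.1
          have := h m
          tauto
      rw [this]
      have hi : Measurable fun t : Fin n → ℝ => t i := measurable_pi_apply i
      have hj : Measurable fun t : Fin n → ℝ => t j := measurable_pi_apply j
      refine (hcomp i j).inter ((measurableSet_lt (hi.dist hj) (hi.sub_const a)).inter
        ((measurableSet_lt (hi.dist hj) (hi.const_sub b)).inter (.iInter fun m =>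
          (hcomp i m).compl.union ((hne m j).compl.union
            (measurableSet_lt (hi.dist hj) (hi.dist (measurable_pi_apply m)))))))
    have : {t : Fin n → ℝ | (tupleRound a b t (k + 1)).Adj (t i) (t j)} =
        {t | (tupleRound a b t k).Adj (t i) (t j)} ∪
        ({t | Arrow (Icc a b) (range t ∩ Icc a b) (fun _ => 2) (tupleRound a b t k) (t i) (t j)} ∩
          {t | Arrow (Icc a b) (range t ∩ Icc a b) (fun _ => 2)
            (tupleRound a b t k) (t j) (t i)}) := by
      ext t
      simp only [tupleRound, coreRound_succ]
      rfl
    rw [this]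
    exact (ih i j).union ((harrow i j).inter (harrow j i))

theorem measurableSet_walk (m : ℕ) (i j : Fin n) :
    MeasurableSet {t : Fin n → ℝ |
      ∃ p : (coreMatching (Icc a b) (range t ∩ Icc a b) fun _ => 2).Walk (t i) (t j),
        p.length = m} := by
  induction m generalizing i with
  | zero =>
    have : {t : Fin n → ℝ |
        ∃ p : (coreMatching (Icc a b) (range t ∩ Icc a b) fun _ => 2).Walk (t i) (t j),
          p.length = 0} = {t | t i = t j} := by
      ext t
      exact SimpleGraph.Walk.exists_length_eq_zero_iff
    rw [this]
    exact measurableSet_eq_fun (measurable_pi_apply i) (measurable_pi_apply j)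
  | succ m ih =>
    have : {t : Fin n → ℝ |
        ∃ p : (coreMatching (Icc a b) (range t ∩ Icc a b) fun _ => 2).Walk (t i) (t j),
          p.length = m + 1} = ⋃ u : Fin n, (⋃ k, {t | (tupleRound a b t k).Adj (t i) (t u)}) ∩
        {t | ∃ p : (coreMatching (Icc a b) (range t ∩ Icc a b) fun _ => 2).Walk (t u) (t j),
          p.length = m} := by
      ext t
      simp only [mem_iUnion, mem_inter_iff, mem_ofPred_eq]
      constructor
      · rintro ⟨p, hp⟩
        obtain ⟨w, h, q, hq⟩ := exists_cons_of_length_succ p hp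
        obtain ⟨u, rfl⟩ := (isPartialStable_coreMatching.mem h.symm).1
        exact ⟨u, coreMatching_adj_iff.1 h, q, hq⟩
      · rintro ⟨u, hu, p, hp⟩
        exact ⟨.cons (coreMatching_adj_iff.2 hu) p, by simpa using hp⟩
    rw [this]
    exact .iUnion fun u =>
      (MeasurableSet.iUnion fun k => measurableSet_tupleRound k i u).inter (ih u)

theorem measurableSet_isGood_range :
    MeasurableSet {t : Fin n → ℝ | IsGood (range t) a b} := by
  have : {t : Fin n → ℝ | IsGood (range t) a b} = ⋃ i, ⋃ j,
      ({t | t i ∈ Icc a b} ∩ ({t | t j ∈ Icc a b} ∩ ({t | t i ∈ Icc a (3 / 4 * a + 1 / 4 * b)} ∩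
        ({t | t j ∈ Icc (1 / 4 * a + 3 / 4 * b) b} ∩ ⋃ m, {t : Fin n → ℝ |
      ∃ p : (coreMatching (Icc a b) (range t ∩ Icc a b) fun _ => 2).Walk (t i) (t j),
        p.length = m})))) := by
    ext t
    simp only [mem_iUnion, mem_inter_iff, mem_ofPred_eq]
    constructor
    · rintro ⟨x, ⟨⟨i, rfl⟩, hx⟩, y, ⟨⟨j, rfl⟩, hy⟩, h1, h2, ⟨p⟩⟩
      exact ⟨i, j, hx, hy, h1, h2, _, p, rfl⟩
    · rintro ⟨i, j, hx, hy, h1, h2, _, p, -⟩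
      exact ⟨_, ⟨⟨i, rfl⟩, hx⟩, _, ⟨⟨j, rfl⟩, hy⟩, h1, h2, ⟨p⟩⟩
  rw [this]
  have hm : ∀ (i : Fin n) (c d : ℝ), MeasurableSet {t : Fin n → ℝ | t i ∈ Icc c d} := fun i c d =>
    measurable_pi_apply i measurableSet_Icc
  exact .iUnion fun i => .iUnion fun j => (hm i _ _).inter ((hm j _ _).inter ((hm i _ _).inter
    ((hm j _ _).inter (.iUnion fun m => measurableSet_walk m i j))))

end Tuples

/-! ### The measurable space of finite configurations. -/

theorem orderEmbOfFin_lt_iff (s : Finset ℝ) {k : ℕ} (hk : k < s.card) (t : ℝ) :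
    s.orderEmbOfFin rfl ⟨k, hk⟩ < t ↔ k < (s.filter (· < t)).card := by
  constructor
  · intro h
    have hsub : (Finset.Iic (⟨k, hk⟩ : Fin s.card)).map (s.orderEmbOfFin rfl).toEmbedding ⊆
        s.filter (· < t) := by
      intro x hx
      obtain ⟨i, hi, rfl⟩ := Finset.mem_map.1 hx
      refine Finset.mem_filter.2 ⟨s.orderEmbOfFin_mem rfl i, lt_of_le_of_lt ?_ h⟩
      exact (s.orderEmbOfFin rfl).monotone (Finset.mem_Iic.1 hi)
    have := Finset.card_le_card hsub
    rw [Finset.card_map, Fin.card_Iic] at this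
    exact this
  · intro h
    by_contra! hle
    have hsub : s.filter (· < t) ⊆
        (Finset.Iio (⟨k, hk⟩ : Fin s.card)).map (s.orderEmbOfFin rfl).toEmbedding := by
      intro x hx
      obtain ⟨hxs, hxt⟩ := Finset.mem_filter.1 hx
      obtain ⟨i, rfl⟩ : x ∈ range (s.orderEmbOfFin rfl) := by
        rw [Finset.range_orderEmbOfFin]; exact hxs
      refine Finset.mem_map.2 ⟨i, Finset.mem_Iio.2 ?_, rfl⟩
      exact (s.orderEmbOfFin rfl).lt_iff_lt.1 (hxt.trans_le hle)
    have := Finset.card_le_card hsub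
    rw [Finset.card_map, Fin.card_Iio] at this
    exact absurd h (not_lt.2 this)

/-- Finite point configurations in `[0, L)`. -/
structure Config (L : ℝ) where
  pts : Finset ℝ
  mem_Ico : ∀ x ∈ pts, x ∈ Ico 0 L

namespace Config

variable {L : ℝ}

/-- The numbers of points to the left of the points dividing `[0, L)` into `m + 1` equal parts. -/
noncomputable def count (m : ℕ) (P : Config L) (j : Fin (m + 1)) : ℕ :=
  (P.pts.filter (· < (j + 1) * L / (m + 1))).card

/-- Counts on equal subdivisions suffice to make the ordered points measurable, and their joint laws
are directly accessible for a Poisson process. -/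
noncomputable instance instMeasurableSpace : MeasurableSpace (Config L) :=
  ⨆ m : ℕ, MeasurableSpace.comap (count m) inferInstance

theorem measurable_count (m : ℕ) : Measurable (count (L := L) m) :=
  Measurable.of_comap_le (le_iSup (fun m : ℕ => MeasurableSpace.comap (count (L := L) m) _) m)

theorem measurable_count_apply (m : ℕ) (j : Fin (m + 1)) :
    Measurable fun P : Config L => P.count m j :=
  (measurable_pi_apply j).comp (measurable_count m)

theorem measurable_card : Measurable fun P : Config L => P.pts.card := by
  convert measurable_count_apply (L := L) 0 0 using 2 with P
  rw [count, Finset.filter_true_of_mem]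
  intro x hx
  simpa using (P.mem_Ico x hx).2

/-- The `k`-th point of the configuration from the left, with value `0` if there is none. -/
noncomputable def point (k : ℕ) (P : Config L) : ℝ :=
  if h : k < P.pts.card then P.pts.orderEmbOfFin rfl ⟨k, h⟩ else 0

theorem point_mem_Ico (hL : 0 < L) (k : ℕ) (P : Config L) : point k P ∈ Ico 0 L := by
  rw [point]
  split_ifs with h
  · exact P.mem_Ico _ (P.pts.orderEmbOfFin_mem rfl _)
  · exact ⟨le_rfl, hL⟩

theorem measurable_point (hL : 0 < L) (k : ℕ) : Measurable (point (L := L) k) := by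
  have h : Measurable fun P : Config L => point k P / L := by
    rw [BorelSpace.measurable_eq (α := ℝ), Real.borel_eq_generateFrom_Iio_rat]
    refine measurable_generateFrom fun s hs => ?_
    obtain ⟨q, rfl⟩ := mem_iUnion.1 hs
    rcases le_or_gt q 0 with hq | hq
    · convert MeasurableSet.empty
      refine eq_empty_of_forall_notMem fun P hP => ?_
      have h1 : point k P / L < q := hP
      have h2 : 0 ≤ point k P / L := div_nonneg (point_mem_Ico hL k P).1 hL.le
      have h3 : (q : ℝ) ≤ 0 := by exact_mod_cast hq
      linarith
    rcases le_or_gt 1 q with hq1 | hq1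
    · convert MeasurableSet.univ
      refine eq_univ_of_forall fun P => ?_
      have h2 : point k P / L < 1 := (div_lt_one hL).2 (point_mem_Ico hL k P).2
      have h3 : (1 : ℝ) ≤ q := by exact_mod_cast hq1
      exact h2.trans_le h3
    obtain ⟨m, hm⟩ : ∃ m, q.den = m + 1 := Nat.exists_eq_succ_of_ne_zero q.den_nz
    obtain ⟨j, hj⟩ : ∃ j : ℕ, q.num = (j : ℤ) + 1 :=
      ⟨(q.num - 1).toNat, by have := Rat.num_pos.2 hq; omega⟩
    have hqR : (q : ℝ) = (j + 1) / (m + 1) := by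
      rw [Rat.cast_def, hm, hj]; push_cast; ring
    have hjm : j < m + 1 := by
      have : (q : ℝ) < 1 := by exact_mod_cast hq1
      rw [hqR, div_lt_one (by positivity)] at this
      have : (j : ℝ) < m := by linarith
      have : j < m := by exact_mod_cast this
      omega
    -- A missing `k`-th point has the default value `0`, which lies below every positive threshold;
    -- hence the first set of the union.
    have hset : (fun P : Config L => point k P / L) ⁻¹' Iio (q : ℝ) =
        {P | P.pts.card ≤ k} ∪ {P | k < P.count m ⟨j, hjm⟩} := by
      ext P
      simp only [mem_preimage, mem_Iio, mem_union, mem_ofPred_eq]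
      rw [div_lt_iff₀ hL, hqR]
      have hpos : (0 : ℝ) < (j + 1) / (m + 1) * L := by positivity
      have he : ((j : ℝ) + 1) / (m + 1) * L = (j + 1) * L / (m + 1) := by ring
      rw [point]
      split_ifs with h
      · rw [orderEmbOfFin_lt_iff, he]
        exact ⟨.inr, fun h' => h'.resolve_left (not_le.2 h)⟩
      · exact ⟨fun _ => .inl (not_lt.1 h), fun _ => hpos⟩
    rw [hset]
    exact (measurable_card measurableSet_Iic).union
      (measurable_count_apply m ⟨j, hjm⟩ measurableSet_Ioi)
  have := h.mul_const L
  simpa [div_mul_cancel₀ _ hL.ne'] using this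

theorem range_point {P : Config L} {n : ℕ} (hn : P.pts.card = n) :
    range (fun i : Fin n => point i P) = P.pts := by
  subst hn
  rw [← Finset.range_orderEmbOfFin P.pts rfl]
  refine congrArg range (funext fun i => ?_)
  rw [point, dif_pos i.2]

theorem measurableSet_isGood (hL : 0 < L) :
    MeasurableSet {P : Config L | IsGood (P.pts : Set ℝ) 0 L} := by
  have : {P : Config L | IsGood (P.pts : Set ℝ) 0 L} = ⋃ n : ℕ, {P | P.pts.card = n} ∩
      (fun P (i : Fin n) => point (L := L) i P) ⁻¹' {t | IsGood (range t) 0 L} := by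
    ext P
    simp only [mem_iUnion, mem_inter_iff, mem_preimage, mem_ofPred_eq]
    constructor
    · intro h
      exact ⟨_, rfl, by rwa [range_point rfl]⟩
    · rintro ⟨n, hn, h⟩
      rwa [range_point hn] at h
  rw [this]
  exact .iUnion fun n => (measurable_card (measurableSet_singleton n)).inter
    (measurable_pi_iff.2 (fun i : Fin n => measurable_point hL i) measurableSet_isGood_range)

theorem count_mul_add (m k : ℕ) (P : Config L) (j : Fin (m + 1))
    (i : Fin ((m + 1) * (k + 1) - 1 + 1)) (hi : (i : ℕ) + 1 = (j + 1) * (k + 1)) :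
    P.count ((m + 1) * (k + 1) - 1) i = P.count m j := by
  have h1 : ((i : ℕ) : ℝ) + 1 = (j + 1) * (k + 1) := by exact_mod_cast hi
  have h2 : (((m + 1) * (k + 1) - 1 : ℕ) : ℝ) + 1 = (m + 1) * (k + 1) := by
    have : (m + 1) * (k + 1) - 1 + 1 = (m + 1) * (k + 1) :=
      Nat.sub_add_cancel (Nat.mul_pos (Nat.succ_pos m) (Nat.succ_pos k))
    exact_mod_cast this
  rw [count, count, h1, h2]
  have h3 : ((j : ℝ) + 1) * (k + 1) * L / ((m + 1) * (k + 1)) = (j + 1) * L / (m + 1) := by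
    field_simp
  rw [h3]

/-- The parameter `m` stands for `m + 1` parts, so the refinement into `(m + 1) * (k + 1)` parts has
parameter one less. Common refinements make the generating family directed, which gives a π-system.
-/
theorem comap_count_le (m k : ℕ) :
    MeasurableSpace.comap (count (L := L) m) inferInstance ≤
      MeasurableSpace.comap (count (L := L) ((m + 1) * (k + 1) - 1)) inferInstance := by
  have hlt : ∀ j : Fin (m + 1), (j + 1) * (k + 1) - 1 < (m + 1) * (k + 1) - 1 + 1 := fun j => by
    have h1 : (j + 1) * (k + 1) ≤ (m + 1) * (k + 1) := Nat.mul_le_mul_right _ j.2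
    have h2 : 0 < (j + 1 : ℕ) * (k + 1) := by positivity
    omega
  have : count (L := L) m = (fun v (j : Fin (m + 1)) => v ⟨(j + 1) * (k + 1) - 1, hlt j⟩) ∘
      count ((m + 1) * (k + 1) - 1) := by
    funext P j
    refine (count_mul_add m k P j _ ?_).symm
    exact Nat.sub_add_cancel (Nat.mul_pos (Nat.succ_pos _) (Nat.succ_pos _))
  conv_lhs => rw [this]
  rw [← MeasurableSpace.comap_comp]
  refine MeasurableSpace.comap_mono (Measurable.comap_le ?_)
  exact measurable_pi_iff.2 fun j => measurable_pi_apply _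

theorem directed_comap_count :
    Directed (· ≤ ·) fun m : ℕ => MeasurableSpace.comap (count (L := L) m) inferInstance := by
  intro m k
  refine ⟨(m + 1) * (k + 1) - 1, comap_count_le m k, ?_⟩
  have := comap_count_le (L := L) k m
  rwa [mul_comm (k + 1)] at this

/-- Finite measures on configurations are determined by the laws of the counts. -/
theorem ext_of_map_count {μ ν : Measure (Config L)} [IsProbabilityMeasure μ]
    [IsProbabilityMeasure ν] (h : ∀ m, μ.map (count m) = ν.map (count m)) : μ = ν := by
  refine ext_of_generate_finite
    (⋃ m : ℕ, {s | MeasurableSet[MeasurableSpace.comap (count (L := L) m) inferInstance] s})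
    (MeasurableSpace.generateFrom_iUnion_measurableSet _).symm
    (isPiSystem_iUnion_of_directed_le _ (fun m =>
      @MeasurableSpace.isPiSystem_measurableSet _ (MeasurableSpace.comap (count m) _)) ?_) ?_
    (by simp)
  · intro m k
    obtain ⟨l, h1, h2⟩ := directed_comap_count (L := L) m k
    exact ⟨l, h1, h2⟩
  · intro s hs
    obtain ⟨m, t, ht, rfl⟩ := mem_iUnion.1 hs
    rw [← Measure.map_apply (measurable_count m) ht, h m,
      Measure.map_apply (measurable_count m) ht]

end Config

/-! ### Stationarity and independence of the Poisson configurations. -/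

/-- The configuration of the points of `X` in `[a, a + L)`, seen from `a`. -/
noncomputable def configOf (X : Set ℝ) (hX : ∀ B, Bornology.IsBounded B → (X ∩ B).Finite)
    (a L : ℝ) : Config L where
  pts := (((hX (Ico a (a + L)) (Metric.isBounded_Ico a (a + L))).preimage
    (add_left_injective a).injOn).subset (t := (· + a) ⁻¹' X ∩ Ico 0 L) fun x hx =>
      ⟨hx.1, by linarith [hx.2.1], by linarith [hx.2.2]⟩).toFinset
  mem_Ico x hx := ((Set.Finite.mem_toFinset _).1 hx).2

theorem mem_configOf {X : Set ℝ} {hX : ∀ B, Bornology.IsBounded B → (X ∩ B).Finite}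
    {a L x : ℝ} : x ∈ (configOf X hX a L).pts ↔ x + a ∈ X ∧ x ∈ Ico 0 L :=
  Set.Finite.mem_toFinset _

/-- Configurations live on half-open intervals so that touching intervals are independent; the price
is the right endpoint, which is almost surely not a point. -/
theorem isGood_configOf_iff {X : Set ℝ} {hX : ∀ B, Bornology.IsBounded B → (X ∩ B).Finite}
    {a L : ℝ} (hL : a + L ∉ X) :
    IsGood ((configOf X hX a L).pts : Set ℝ) 0 L ↔ IsGood X a (a + L) := by
  have h : ((configOf X hX a L).pts : Set ℝ) ∩ Icc 0 L = (· + a) ⁻¹' X ∩ Icc 0 L := by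
    ext x
    simp only [mem_inter_iff, Finset.mem_coe, mem_configOf, mem_preimage]
    constructor
    · rintro ⟨⟨h1, -⟩, h2⟩
      exact ⟨h1, h2⟩
    · rintro ⟨h1, h2⟩
      refine ⟨⟨h1, h2.1, lt_of_le_of_ne h2.2 ?_⟩, h2⟩
      rintro rfl
      exact hL (by rwa [add_comm])
  rw [IsGood, h, ← IsGood, isGood_preimage_add, zero_add, add_comm L]

/-- The `i`-th of the `m + 1` equal parts of `[a, a + L)`. -/
def gridCell (a L : ℝ) (m i : ℕ) : Set ℝ := Ico (a + i * L / (m + 1)) (a + (i + 1) * L / (m + 1))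

theorem monotone_grid {L : ℝ} (hL : 0 ≤ L) (a : ℝ) (m : ℕ) :
    Monotone fun i : ℕ => a + i * L / (m + 1) := fun i j h => by
  have : (i : ℝ) ≤ j := by exact_mod_cast h
  dsimp only
  gcongr

theorem pairwise_disjoint_gridCell {L : ℝ} (hL : 0 ≤ L) (a : ℝ) (m : ℕ) :
    Pairwise fun i j => Disjoint (gridCell a L m i) (gridCell a L m j) := by
  have := (monotone_grid hL a m).pairwise_disjoint_on_Ico_succ
  intro i j hij
  simpa [Function.onFun, gridCell] using this hij

theorem gridCell_subset {a L : ℝ} (hL : 0 ≤ L) {m i : ℕ} (hi : i < m + 1) :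
    gridCell a L m i ⊆ Ico a (a + L) := by
  have h1 := monotone_grid hL a m (Nat.zero_le i)
  have h2 := monotone_grid hL a m hi
  have hm : (m : ℝ) + 1 ≠ 0 := by positivity
  simp only [Nat.cast_zero, zero_mul, zero_div, add_zero] at h1
  push_cast at h2
  rw [mul_div_cancel_left₀ _ hm] at h2
  exact Ico_subset_Ico h1 h2

theorem ncard_Ico_eq_sum {X : Set ℝ} (hX : ∀ B, Bornology.IsBounded B → (X ∩ B).Finite)
    {a L : ℝ} (hL : 0 ≤ L) (m j : ℕ) :
    (X ∩ Ico a (a + j * L / (m + 1))).ncard =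
      ∑ i ∈ Finset.range j, (X ∩ gridCell a L m i).ncard := by
  induction j with
  | zero => simp
  | succ j ih =>
    have h1 := monotone_grid hL a m (Nat.zero_le j)
    have h2 := monotone_grid hL a m (Nat.le_succ j)
    simp only [Nat.cast_zero, zero_mul, zero_div, add_zero] at h1
    rw [Finset.sum_range_succ, ← ih, gridCell, ← ncard_union_eq _ (hX _ (Metric.isBounded_Ico _ _))
      (hX _ (Metric.isBounded_Ico _ _)), ← inter_union_distrib_left]
    · have : (j : ℝ) + 1 = (j + 1 : ℕ) := by push_cast; rfl
      rw [this, Ico_union_Ico_eq_Ico h1 h2]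
    · rw [disjoint_left]
      rintro x ⟨-, hx⟩ ⟨-, hx'⟩
      exact absurd hx.2 (not_lt.2 hx'.1)

theorem count_configOf {X : Set ℝ} {hX : ∀ B, Bornology.IsBounded B → (X ∩ B).Finite}
    {a L : ℝ} (hL : 0 ≤ L) (m : ℕ) (j : Fin (m + 1)) :
    (configOf X hX a L).count m j = ∑ i ∈ Finset.univ.filter (· ≤ j),
      (X ∩ gridCell a L m i).ncard := by
  have h1 : ∑ i ∈ Finset.univ.filter (· ≤ j), (X ∩ gridCell a L m i).ncard =
      ∑ i ∈ Finset.range (j + 1), (X ∩ gridCell a L m i).ncard := by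
    refine Finset.sum_bij (fun i _ => (i : ℕ)) (fun i hi => ?_) (fun i _ i' _ h => Fin.ext h)
      (fun i hi => ?_) fun _ _ => rfl
    · have : i ≤ j := (Finset.mem_filter.1 hi).2
      exact Finset.mem_range.2 (Nat.lt_succ_of_le this)
    · have := Finset.mem_range.1 hi
      exact ⟨⟨i, by omega⟩, Finset.mem_filter.2 ⟨Finset.mem_univ _, Nat.le_of_lt_succ this⟩, rfl⟩
  rw [h1, ← ncard_Ico_eq_sum hX hL, Config.count]
  have h2 := monotone_grid hL a m j.2
  have hm : (m : ℝ) + 1 ≠ 0 := by positivity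
  push_cast at h2 ⊢
  rw [mul_div_cancel_left₀ _ hm] at h2
  rw [← ncard_coe_finset]
  refine ncard_congr (fun x _ => x + a) (fun x hx => ?_) (fun x y _ _ h => by simpa using h)
    fun y hy => ⟨y - a, ?_, by simp⟩
  · obtain ⟨h3, h4⟩ := Finset.mem_filter.1 hx
    obtain ⟨h5, h6⟩ := mem_configOf.1 h3
    exact ⟨h5, by linarith [h6.1], by linarith⟩
  · refine Finset.mem_coe.2 (Finset.mem_filter.2 ⟨mem_configOf.2 ⟨by simpa using hy.1, ?_, ?_⟩, ?_⟩)
    · linarith [hy.2.1]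
    · linarith [hy.2.2]
    · linarith [hy.2.2]

namespace IsUnitPoissonProcess

variable {Ω : Type*} [MeasurableSpace Ω] {Pr : Measure Ω} {X : Ω → Set ℝ}

/-- The vector of the numbers of points in the parts of `[a, a + L)`. -/
noncomputable def cellCounts (X : Ω → Set ℝ) (a L : ℝ) (m : ℕ) (ω : Ω) (i : Fin (m + 1)) : ℕ :=
  (X ω ∩ gridCell a L m i).ncard

theorem measurable_cellCounts (hX : IsUnitPoissonProcess Pr X) (a L : ℝ) (m : ℕ) :
    Measurable (cellCounts X a L m) :=
  measurable_pi_iff.2 fun _ =>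
    hX.measurable_count _ measurableSet_Ico (Metric.isBounded_Ico _ _)

theorem map_cellCounts [IsProbabilityMeasure Pr] (hX : IsUnitPoissonProcess Pr X) {L : ℝ}
    (hL : 0 ≤ L) (a : ℝ) (m : ℕ) :
    Pr.map (cellCounts X a L m) =
      Measure.pi fun _ => poissonMeasure (ENNReal.ofReal (L / (m + 1))).toNNReal := by
  have hind := hX.indep_count (m + 1) (fun i => gridCell a L m i) (fun i => measurableSet_Ico)
    (fun i => Metric.isBounded_Ico _ _)
    (fun i j hij => pairwise_disjoint_gridCell hL a m fun h => hij (Fin.ext h))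
  have := (iIndepFun_iff_map_fun_eq_pi_map fun i : Fin (m + 1) =>
    (hX.measurable_count (gridCell a L m i) measurableSet_Ico
      (Metric.isBounded_Ico _ _)).aemeasurable).1 hind
  refine this.trans (congrArg Measure.pi (funext fun i => ?_))
  rw [gridCell, hX.map_count _ measurableSet_Ico (Metric.isBounded_Ico _ _), Real.volume_Ico]
  congr 3
  field_simp
  ring

theorem indepFun_cellCounts (hX : IsUnitPoissonProcess Pr X) {L : ℝ} (hL : 0 ≤ L) {a b : ℝ}
    (hab : a + L ≤ b) (m k : ℕ) :
    IndepFun (cellCounts X a L m) (cellCounts X b L k) Pr := by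
  let B : Fin ((m + 1) + (k + 1)) → Set ℝ :=
    Fin.append (fun i : Fin (m + 1) => gridCell a L m i) (fun i : Fin (k + 1) => gridCell b L k i)
  have hB1 : ∀ i, B (Fin.castAdd _ i) = gridCell a L m i := fun i => Fin.append_left _ _ _
  have hB2 : ∀ i, B (Fin.natAdd _ i) = gridCell b L k i := fun i => Fin.append_right _ _ _
  have hmeas : ∀ i, MeasurableSet (B i) := fun i => by
    refine Fin.addCases (fun i => ?_) (fun i => ?_) i
    · rw [hB1]; exact measurableSet_Ico
    · rw [hB2]; exact measurableSet_Ico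
  have hbdd : ∀ i, Bornology.IsBounded (B i) := fun i => by
    refine Fin.addCases (fun i => ?_) (fun i => ?_) i
    · rw [hB1]; exact Metric.isBounded_Ico _ _
    · rw [hB2]; exact Metric.isBounded_Ico _ _
  have hcross : ∀ (i : Fin (m + 1)) (j : Fin (k + 1)),
      Disjoint (gridCell a L m i) (gridCell b L k j) := fun i j => by
    refine Disjoint.mono (gridCell_subset hL i.2) (gridCell_subset hL j.2) ?_
    rw [disjoint_left]
    intro x hx hx'
    linarith [hx.2, hx'.1]
  have hdisj : Pairwise fun i j => Disjoint (B i) (B j) := by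
    intro i j
    refine Fin.addCases (fun i => ?_) (fun i => ?_) i <;>
      refine Fin.addCases (fun j => ?_) (fun j => ?_) j <;> intro hij <;>
      simp only [hB1, hB2]
    · exact pairwise_disjoint_gridCell hL a m fun h => hij (by rw [Fin.ext h])
    · exact hcross i j
    · exact (hcross j i).symm
    · exact pairwise_disjoint_gridCell hL b k fun h => hij (by rw [Fin.ext h])
  have hind := hX.indep_count _ B hmeas hbdd hdisj
  have := hind.indepFun_finset (Finset.univ.map (Fin.castAddEmb (k + 1)))
    (Finset.univ.map (Fin.natAddEmb (m + 1))) ?_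
    fun i => hX.measurable_count _ (hmeas i) (hbdd i)
  · have h2 := this.comp
      (φ := fun v (i : Fin (m + 1)) => v ⟨Fin.castAdd _ i, by simp⟩)
      (ψ := fun v (i : Fin (k + 1)) => v ⟨Fin.natAdd _ i, by simp⟩)
      (measurable_pi_iff.2 fun i => measurable_pi_apply _)
      (measurable_pi_iff.2 fun i => measurable_pi_apply _)
    convert h2 using 1
    · funext ω i
      simp [cellCounts, hB1]
    · funext ω i
      simp [cellCounts, hB2]
  · rw [Finset.disjoint_left]
    intro x h1 h2
    obtain ⟨i, -, rfl⟩ := Finset.mem_map.1 h1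
    obtain ⟨j, -, hj⟩ := Finset.mem_map.1 h2
    have := congrArg Fin.val hj
    simp at this
    omega

/-- The configuration of the process in `[a, a + L)`, seen from `a`. -/
noncomputable def config (hX : IsUnitPoissonProcess Pr X) (a L : ℝ) (ω : Ω) : Config L :=
  configOf (X ω) (hX.locallyFinite ω) a L

/-- Cumulative sums. -/
def partialSums (m : ℕ) (v : Fin (m + 1) → ℕ) (j : Fin (m + 1)) : ℕ :=
  ∑ i ∈ Finset.univ.filter (· ≤ j), v i

theorem measurable_partialSums (m : ℕ) : Measurable (partialSums m) :=
  measurable_pi_iff.2 fun _ => Finset.measurable_sum _ fun i _ => measurable_pi_apply i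

theorem count_comp_config (hX : IsUnitPoissonProcess Pr X) {L : ℝ} (hL : 0 ≤ L) (a : ℝ) (m : ℕ) :
    Config.count m ∘ hX.config a L = partialSums m ∘ cellCounts X a L m := by
  funext ω j
  exact count_configOf hL m j

theorem measurable_config (hX : IsUnitPoissonProcess Pr X) {L : ℝ} (hL : 0 ≤ L) (a : ℝ) :
    Measurable (hX.config a L) := by
  rw [measurable_iff_comap_le, Config.instMeasurableSpace, MeasurableSpace.comap_iSup]
  refine iSup_le fun m => ?_
  rw [MeasurableSpace.comap_comp, count_comp_config hX hL]
  exact ((measurable_partialSums m).comp (hX.measurable_cellCounts a L m)).comap_le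

/-- The law of the process is invariant under translations. -/
theorem map_config_eq [IsProbabilityMeasure Pr] (hX : IsUnitPoissonProcess Pr X) {L : ℝ}
    (hL : 0 ≤ L) (a b : ℝ) : Pr.map (hX.config a L) = Pr.map (hX.config b L) := by
  have := Measure.isProbabilityMeasure_map (μ := Pr) (hX.measurable_config hL a).aemeasurable
  have := Measure.isProbabilityMeasure_map (μ := Pr) (hX.measurable_config hL b).aemeasurable
  refine Config.ext_of_map_count fun m => ?_
  rw [Measure.map_map (Config.measurable_count m) (hX.measurable_config hL a),
    Measure.map_map (Config.measurable_count m) (hX.measurable_config hL b),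
    count_comp_config hX hL, count_comp_config hX hL,
    ← Measure.map_map (measurable_partialSums m) (hX.measurable_cellCounts a L m),
    ← Measure.map_map (measurable_partialSums m) (hX.measurable_cellCounts b L m),
    map_cellCounts hX hL, map_cellCounts hX hL]

/-- Independence of the count vectors on every pair of subdivisions passes to the generated
σ-algebras, by directedness, one side at a time. -/
theorem indepFun_config [IsProbabilityMeasure Pr] (hX : IsUnitPoissonProcess Pr X) {L : ℝ}
    (hL : 0 ≤ L) {a b : ℝ} (hab : a + L ≤ b) :
    IndepFun (hX.config a L) (hX.config b L) Pr := by
  have hle : ∀ a m, MeasurableSpace.comap (Config.count m ∘ hX.config a L) inferInstance ≤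
      (inferInstance : MeasurableSpace Ω) := fun a m =>
    ((Config.measurable_count m).comp (hX.measurable_config hL a)).comap_le
  have hdir : ∀ a, Directed (· ≤ ·) fun m : ℕ =>
      MeasurableSpace.comap (Config.count m ∘ hX.config a L) inferInstance := fun a m k => by
    obtain ⟨l, h1, h2⟩ := Config.directed_comap_count (L := L) m k
    refine ⟨l, ?_, ?_⟩ <;> simp only [← MeasurableSpace.comap_comp]
    exacts [MeasurableSpace.comap_mono h1, MeasurableSpace.comap_mono h2]
  have hcomap : ∀ a, MeasurableSpace.comap (hX.config a L) Config.instMeasurableSpace =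
      ⨆ m : ℕ, MeasurableSpace.comap (Config.count m ∘ hX.config a L) inferInstance := fun a => by
    rw [Config.instMeasurableSpace, MeasurableSpace.comap_iSup]
    simp only [MeasurableSpace.comap_comp]
  have hpair : ∀ m k, Indep (MeasurableSpace.comap (Config.count m ∘ hX.config a L) inferInstance)
      (MeasurableSpace.comap (Config.count k ∘ hX.config b L) inferInstance) Pr := fun m k => by
    rw [count_comp_config hX hL, count_comp_config hX hL]
    exact (hX.indepFun_cellCounts hL hab m k).comp (measurable_partialSums m)
      (measurable_partialSums k)
  rw [IndepFun_iff_Indep, hcomap, hcomap]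
  refine indep_iSup_of_directed_le (fun m => ?_) (hle a) (iSup_le (hle b)) (hdir a)
  exact (indep_iSup_of_directed_le (fun k => (hpair m k).symm) (hle b) (hle a m) (hdir b)).symm

end IsUnitPoissonProcess

/-! ### Almost surely no point is equidistant from two others. -/

theorem poissonMeasure_one_le (r : NNReal) : poissonMeasure r {n | 1 ≤ n} ≤ r := by
  have h : {n : ℕ | 1 ≤ n} = {0}ᶜ := by ext n; simp [Nat.one_le_iff_ne_zero]
  have h1 : (poissonMeasure r).real {n | 1 ≤ n} ≤ r := by
    rw [h, probReal_compl_eq_one_sub (measurableSet_singleton 0), poissonMeasure_real_singleton]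
    have := Real.add_one_le_exp (-(r : ℝ))
    simp
    linarith
  rw [← ENNReal.ofReal_coe_nnreal, ← ofReal_measureReal]
  exact ENNReal.ofReal_le_ofReal h1

/-- From `exp (-r) ≥ 1 - r` one gets `1 - (1 + r) * exp (-r) ≤ 1 - (1 + r) * (1 - r) = r ^ 2`. -/
theorem poissonMeasure_two_le (r : NNReal) : poissonMeasure r {n | 2 ≤ n} ≤ (r : ENNReal) ^ 2 := by
  have h : {n : ℕ | 2 ≤ n} = ({0} ∪ {1})ᶜ := by ext n; simp; omega
  have h1 : (poissonMeasure r).real {n | 2 ≤ n} ≤ r ^ 2 := by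
    rw [h, probReal_compl_eq_one_sub .of_discrete, measureReal_union (by simp) .of_discrete,
      poissonMeasure_real_singleton, poissonMeasure_real_singleton]
    have h2 := Real.add_one_le_exp (-(r : ℝ))
    have h3 : (0 : ℝ) ≤ r := r.2
    simp
    nlinarith
  rw [← ENNReal.ofReal_coe_nnreal, ← ofReal_measureReal, ← ENNReal.ofReal_pow r.coe_nonneg]
  exact ENNReal.ofReal_le_ofReal h1

theorem exists_mem_gridCell {a L x : ℝ} (hL : 0 < L) (hx : x ∈ Ico a (a + L)) (m : ℕ) :
    ∃ i < m + 1, x ∈ gridCell a L m i := by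
  have hm : (0 : ℝ) < m + 1 := by positivity
  have h0 : 0 ≤ (x - a) * (m + 1) / L := by
    have : 0 ≤ x - a := by linarith [hx.1]
    positivity
  refine ⟨⌊(x - a) * (m + 1) / L⌋₊, ?_, ?_, ?_⟩
  · rw [Nat.floor_lt h0, div_lt_iff₀ hL]
    push_cast
    nlinarith [hx.2]
  · have := Nat.floor_le h0
    rw [le_div_iff₀ hL] at this
    have : (⌊(x - a) * (m + 1) / L⌋₊ : ℝ) * L / (m + 1) ≤ x - a := by
      rwa [div_le_iff₀ hm]
    linarith
  · have := Nat.lt_floor_add_one ((x - a) * (m + 1) / L)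
    rw [div_lt_iff₀ hL] at this
    have : x - a < (⌊(x - a) * (m + 1) / L⌋₊ + 1 : ℝ) * L / (m + 1) := by
      rwa [lt_div_iff₀ hm]
    linarith

theorem one_le_ncard_of_mem {X : Set ℝ} (hX : ∀ B, Bornology.IsBounded B → (X ∩ B).Finite)
    {B : Set ℝ} (hB : Bornology.IsBounded B) {x : ℝ} (hx : x ∈ X) (hxB : x ∈ B) :
    1 ≤ (X ∩ B).ncard :=
  (ncard_pos (hX B hB)).2 ⟨x, hx, hxB⟩

theorem two_le_ncard_of_mem {X : Set ℝ} (hX : ∀ B, Bornology.IsBounded B → (X ∩ B).Finite)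
    {B : Set ℝ} (hB : Bornology.IsBounded B) {x y : ℝ} (hxy : x ≠ y) (hx : x ∈ X) (hxB : x ∈ B)
    (hy : y ∈ X) (hyB : y ∈ B) : 2 ≤ (X ∩ B).ncard := by
  rw [← ncard_pair hxy]
  refine ncard_le_ncard ?_ (hX B hB)
  rintro z (rfl | rfl)
  exacts [⟨hx, hxB⟩, ⟨hy, hyB⟩]

namespace IsUnitPoissonProcess

variable {Ω : Type*} [MeasurableSpace Ω] {Pr : Measure Ω} {X : Ω → Set ℝ}

theorem measure_one_le (hX : IsUnitPoissonProcess Pr X) {B : Set ℝ} (hB : MeasurableSet B)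
    (hb : Bornology.IsBounded B) : Pr {ω | 1 ≤ (X ω ∩ B).ncard} ≤ volume B := by
  have h := poissonMeasure_one_le (volume B).toNNReal
  rw [← hX.map_count B hB hb, Measure.map_apply (hX.measurable_count B hB hb) .of_discrete] at h
  exact h.trans ENNReal.coe_toNNReal_le_self

theorem measure_two_le (hX : IsUnitPoissonProcess Pr X) {B : Set ℝ} (hB : MeasurableSet B)
    (hb : Bornology.IsBounded B) : Pr {ω | 2 ≤ (X ω ∩ B).ncard} ≤ volume B ^ 2 := by
  have h := poissonMeasure_two_le (volume B).toNNReal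
  rw [← hX.map_count B hB hb, Measure.map_apply (hX.measurable_count B hB hb) .of_discrete] at h
  exact h.trans (by gcongr; exact ENNReal.coe_toNNReal_le_self)

theorem ae_notMem (hX : IsUnitPoissonProcess Pr X) (c : ℝ) : ∀ᵐ ω ∂Pr, c ∉ X ω := by
  refine measure_mono_null (t := {ω | 1 ≤ (X ω ∩ {c}).ncard}) (fun ω hω => ?_) ?_
  · exact one_le_ncard_of_mem (hX.locallyFinite ω) Bornology.isBounded_singleton
      (not_not.1 hω) rfl
  · exact le_antisymm ((hX.measure_one_le (measurableSet_singleton c)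
      Bornology.isBounded_singleton).trans (by simp)) zero_le

theorem measure_three_cells_le (hX : IsUnitPoissonProcess Pr X) {a L : ℝ} (hL : 0 ≤ L) (m : ℕ)
    {i j k : ℕ} (hij : i < j) (hjk : j < k) :
    Pr {ω | 1 ≤ (X ω ∩ gridCell a L m i).ncard ∧ 1 ≤ (X ω ∩ gridCell a L m j).ncard ∧
      1 ≤ (X ω ∩ gridCell a L m k).ncard} ≤ ENNReal.ofReal (L / (m + 1)) ^ 3 := by
  have hvol : ∀ i, Pr {ω | 1 ≤ (X ω ∩ gridCell a L m i).ncard} ≤ ENNReal.ofReal (L / (m + 1)) := by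
    intro i
    refine (hX.measure_one_le measurableSet_Ico (Metric.isBounded_Ico _ _)).trans_eq ?_
    rw [Real.volume_Ico]
    congr 1
    field_simp
    ring
  have hdisj := pairwise_disjoint_gridCell hL a m
  have hind := hX.indep_count 3 ![gridCell a L m i, gridCell a L m j, gridCell a L m k]
    (by intro l; fin_cases l <;> exact measurableSet_Ico)
    (by intro l; fin_cases l <;> exact Metric.isBounded_Ico _ _)
    (by
      intro l l' hl
      fin_cases l <;> fin_cases l' <;>
        first
        | exact absurd rfl hl
        | exact hdisj (by omega))
  have h := hind.measure_inter_preimage_eq_mul Finset.univ (sets := fun _ => {n : ℕ | 1 ≤ n})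
    (fun _ _ => .of_discrete)
  rw [Fin.prod_univ_three] at h
  calc _ = _ := by
        congr 1
        ext ω
        simp [Fin.forall_fin_succ]
    _ = _ := h
    _ ≤ ENNReal.ofReal (L / (m + 1)) * ENNReal.ofReal (L / (m + 1)) *
        ENNReal.ofReal (L / (m + 1)) := by
      gcongr
      exacts [hvol i, hvol j, hvol k]
    _ = _ := by ring

/-- Cut into `m + 1` cells of length `δ`. Either two points share a cell, at cost `δ ^ 2` for each
cell, or three different cells are occupied. The cells of `x` and `y` then leave only three choices
for that of `z`, at total cost `3 * (m + 1) ^ 2 * δ ^ 3`. Both contributions are of order `1 / m`.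
-/
theorem measure_isosceles_le (hX : IsUnitPoissonProcess Pr X) {a L : ℝ} (hL : 0 < L) (m : ℕ) :
    Pr {ω | ∃ x y z, x < y ∧ y - x = z - y ∧ x ∈ X ω ∧ y ∈ X ω ∧ z ∈ X ω ∧
        x ∈ Ico a (a + L) ∧ y ∈ Ico a (a + L) ∧ z ∈ Ico a (a + L)} ≤
      ENNReal.ofReal ((L ^ 2 + 3 * L ^ 3) / (m + 1)) := by
  have hm : (0 : ℝ) < m + 1 := by positivity
  set δ : ℝ := L / (m + 1) with hδ
  have hδ0 : 0 < δ := by positivity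
  let A : Fin (m + 1) → Set Ω := fun i => {ω | 2 ≤ (X ω ∩ gridCell a L m i).ncard}
  let T : Fin (m + 1) × Fin (m + 1) × Fin 3 → Set Ω := fun p => {ω | ∃ k : ℕ,
    k + p.1 + 1 = 2 * p.2.1 + p.2.2 ∧ (p.1 : ℕ) < p.2.1 ∧ (p.2.1 : ℕ) < k ∧
    1 ≤ (X ω ∩ gridCell a L m p.1).ncard ∧ 1 ≤ (X ω ∩ gridCell a L m p.2.1).ncard ∧
      1 ≤ (X ω ∩ gridCell a L m k).ncard}
  have hsub : {ω | ∃ x y z, x < y ∧ y - x = z - y ∧ x ∈ X ω ∧ y ∈ X ω ∧ z ∈ X ω ∧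
      x ∈ Ico a (a + L) ∧ y ∈ Ico a (a + L) ∧ z ∈ Ico a (a + L)} ⊆ (⋃ i, A i) ∪ ⋃ p, T p := by
    rintro ω ⟨x, y, z, hxy, hyz, hx, hy, hz, hxI, hyI, hzI⟩
    obtain ⟨i, hi, hxi⟩ := exists_mem_gridCell hL hxI m
    obtain ⟨j, hj, hyj⟩ := exists_mem_gridCell hL hyI m
    obtain ⟨k, hk, hzk⟩ := exists_mem_gridCell hL hzI m
    have hb : ∀ i, Bornology.IsBounded (gridCell a L m i) := fun i => Metric.isBounded_Ico _ _
    have hX' := hX.locallyFinite ω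
    by_cases hij : i = j
    · subst hij
      exact .inl (mem_iUnion.2 ⟨⟨i, hi⟩, two_le_ncard_of_mem hX' (hb i) hxy.ne hx hxi hy hyj⟩)
    by_cases hjk : j = k
    · subst hjk
      exact .inl (mem_iUnion.2 ⟨⟨j, hj⟩, two_le_ncard_of_mem hX' (hb j)
        (by linarith : y < z).ne hy hyj hz hzk⟩)
    have hcell : ∀ {x : ℝ} {i : ℕ}, x ∈ gridCell a L m i → i * δ ≤ x - a ∧ x - a < (i + 1) * δ := by
      intro x i hx
      have h1 := hx.1
      have h2 := hx.2
      rw [mul_div_assoc] at h1 h2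
      exact ⟨by linarith, by linarith⟩
    have hlt : ∀ {i j : ℕ}, (i : ℝ) * δ < j * δ → i < j := fun h => by
      exact_mod_cast lt_of_mul_lt_mul_right h hδ0.le
    obtain ⟨x1, x2⟩ := hcell hxi
    obtain ⟨y1, y2⟩ := hcell hyj
    obtain ⟨z1, z2⟩ := hcell hzk
    have c1 : i < j + 1 := hlt (by push_cast; linarith)
    have c2 : j < k + 1 := hlt (by push_cast; linarith)
    have c3 : k + i < 2 * j + 2 := hlt (by push_cast; linarith)
    have c4 : 2 * j < k + i + 2 := hlt (by push_cast; linarith)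
    refine .inr (mem_iUnion.2 ⟨(⟨i, hi⟩, ⟨j, hj⟩, ⟨k + i + 1 - 2 * j, by omega⟩), k, ?_, ?_, ?_,
      one_le_ncard_of_mem hX' (hb i) hx hxi, one_le_ncard_of_mem hX' (hb j) hy hyj,
      one_le_ncard_of_mem hX' (hb k) hz hzk⟩) <;> dsimp only <;> omega
  have hA : ∀ i, Pr (A i) ≤ ENNReal.ofReal (δ ^ 2) := by
    intro i
    refine (hX.measure_two_le measurableSet_Ico (Metric.isBounded_Ico _ _)).trans_eq ?_
    rw [Real.volume_Ico, ENNReal.ofReal_pow hδ0.le]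
    congr 2
    rw [hδ]
    field_simp
    ring
  have hT : ∀ p, Pr (T p) ≤ ENNReal.ofReal (δ ^ 3) := by
    rintro ⟨i, j, e⟩
    rw [ENNReal.ofReal_pow hδ0.le]
    by_cases h : (i : ℕ) < j ∧ (j : ℕ) < 2 * j + e - i - 1
    · refine le_trans (measure_mono ?_) (hX.measure_three_cells_le (a := a) hL.le m h.1 h.2)
      rintro ω ⟨k, hk, -, -, h1⟩
      dsimp only at hk h1
      obtain rfl : k = 2 * j + e - i - 1 := by omega
      exact h1
    · refine le_of_eq_of_le (measure_mono_null (t := ∅) ?_ measure_empty) zero_le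
      rintro ω ⟨k, hk, h1, h2, -⟩
      dsimp only at hk h1 h2
      exact h ⟨h1, by omega⟩
  calc _ ≤ Pr ((⋃ i, A i) ∪ ⋃ p, T p) := measure_mono hsub
    _ ≤ Pr (⋃ i, A i) + Pr (⋃ p, T p) := measure_union_le _ _
    _ ≤ ∑ i, Pr (A i) + ∑ p, Pr (T p) :=
      add_le_add (measure_iUnion_fintype_le _ _) (measure_iUnion_fintype_le _ _)
    _ ≤ ∑ _i : Fin (m + 1), ENNReal.ofReal (δ ^ 2) +
        ∑ _p : Fin (m + 1) × Fin (m + 1) × Fin 3, ENNReal.ofReal (δ ^ 3) :=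
      add_le_add (Finset.sum_le_sum fun i _ => hA i) (Finset.sum_le_sum fun p _ => hT p)
    _ = ENNReal.ofReal ((m + 1) * δ ^ 2 + (m + 1) * (m + 1) * 3 * δ ^ 3) := by
      rw [ENNReal.ofReal_add (by positivity) (by positivity)]
      simp only [Finset.sum_const, Finset.card_univ, Fintype.card_prod, Fintype.card_fin,
        nsmul_eq_mul]
      rw [← ENNReal.ofReal_natCast, ← ENNReal.ofReal_natCast,
        ← ENNReal.ofReal_mul (by positivity), ← ENNReal.ofReal_mul (by positivity)]
      push_cast
      congr 3
      ring
    _ = _ := by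
      congr 1
      rw [hδ]
      field_simp

theorem ae_isoscelesFree (hX : IsUnitPoissonProcess Pr X) : ∀ᵐ ω ∂Pr, IsoscelesFree (X ω) := by
  have h0 : ∀ N : ℕ, ∀ᵐ ω ∂Pr, ¬ ∃ x y z, x < y ∧ y - x = z - y ∧ x ∈ X ω ∧ y ∈ X ω ∧ z ∈ X ω ∧
      x ∈ Ico (-((N : ℝ) + 1)) (-((N : ℝ) + 1) + 2 * (N + 1)) ∧
      y ∈ Ico (-((N : ℝ) + 1)) (-((N : ℝ) + 1) + 2 * (N + 1)) ∧
      z ∈ Ico (-((N : ℝ) + 1)) (-((N : ℝ) + 1) + 2 * (N + 1)) := by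
    intro N
    rw [ae_iff]
    simp only [not_not]
    set L : ℝ := 2 * (N + 1)
    have hL : 0 < L := by positivity
    have ht : Filter.Tendsto (fun m : ℕ => ENNReal.ofReal ((L ^ 2 + 3 * L ^ 3) / ((m : ℝ) + 1)))
        Filter.atTop (nhds 0) := by
      rw [← ENNReal.ofReal_zero]
      refine ENNReal.tendsto_ofReal ?_
      exact (tendsto_const_nhds).div_atTop
        (Filter.tendsto_atTop_add_const_right _ _ tendsto_natCast_atTop_atTop)
    exact le_antisymm (ge_of_tendsto' ht fun m => hX.measure_isosceles_le hL m) zero_le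
  filter_upwards [ae_all_iff.2 h0] with ω hω x hx y hy z hz hyz hd
  obtain ⟨N, hN⟩ := exists_nat_ge (max |x| (max |y| |z|))
  have hxN := abs_le.1 ((le_max_left _ _).trans hN)
  have hyN := abs_le.1 (((le_max_left _ _).trans (le_max_right _ _)).trans hN)
  have hzN := abs_le.1 (((le_max_right _ _).trans (le_max_right _ _)).trans hN)
  have hI : ∀ {w : ℝ}, -(N : ℝ) ≤ w ∧ w ≤ N →
      w ∈ Ico (-((N : ℝ) + 1)) (-((N : ℝ) + 1) + 2 * (N + 1)) := fun hw =>
    ⟨by linarith [hw.1], by linarith [hw.2]⟩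
  rw [Real.dist_eq, Real.dist_eq] at hd
  rcases abs_eq_abs.1 hd with h | h
  · exact hyz (by linarith)
  rcases lt_trichotomy y x with hlt | rfl | hlt
  · exact hω N ⟨y, x, z, hlt, by linarith, hy, hx, hz, hI hyN, hI hxN, hI hzN⟩
  · exact hyz (by linarith)
  · exact hω N ⟨z, x, y, by linarith, by linarith, hz, hx, hy, hI hzN, hI hxN, hI hyN⟩

end IsUnitPoissonProcess

/-! ### Probabilistic renormalization and Borel–Cantelli. -/

namespace IsUnitPoissonProcess

variable {Ω : Type*} [MeasurableSpace Ω] {Pr : Measure Ω} {X : Ω → Set ℝ}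

/-- Replaces the event on `Ω`, not known to be measurable, by the preimage of a measurable set of
configurations, to which law and independence apply. -/
theorem setOf_not_isGood_ae_eq (hX : IsUnitPoissonProcess Pr X) (a L : ℝ) :
    {ω | ¬ IsGood (X ω) a (a + L)} =ᵐ[Pr]
      hX.config a L ⁻¹' {P : Config L | IsGood (P.pts : Set ℝ) 0 L}ᶜ := by
  filter_upwards [hX.ae_notMem (a + L)] with ω hω
  exact propext (not_congr (isGood_configOf_iff (hX := hX.locallyFinite ω) hω)).symm

theorem finite_inter_Icc (hX : IsUnitPoissonProcess Pr X) (ω : Ω) (a b : ℝ) :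
    (X ω ∩ Icc a b).Finite :=
  hX.locallyFinite ω _ (Metric.isBounded_Icc a b)

/-- Intervals of non-positive length are almost surely not good. -/
theorem pos_of_measureReal_isGood_pos (hX : IsUnitPoissonProcess Pr X) {L : ℝ}
    (h : 0 < Pr.real {ω | IsGood (X ω) 0 L}) : 0 < L := by
  by_contra! hL
  have h0 : Pr {ω | IsGood (X ω) 0 L} = 0 := by
    refine measure_mono_null ?_ (hX.ae_notMem 0)
    rintro ω ⟨x, ⟨hx, hx0, hxL⟩, -⟩
    obtain rfl : x = 0 := le_antisymm (hxL.trans hL) hx0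
    exact not_not.2 hx
  rw [measureReal_def, h0] at h
  simp at h

variable [IsProbabilityMeasure Pr]

theorem measureReal_not_isGood (hX : IsUnitPoissonProcess Pr X) {L : ℝ} (hL : 0 < L) (a : ℝ) :
    Pr.real {ω | ¬ IsGood (X ω) a (a + L)} = Pr.real {ω | ¬ IsGood (X ω) 0 L} := by
  have h : ∀ a, Pr.real {ω | ¬ IsGood (X ω) a (a + L)} =
      (Pr.map (hX.config a L)).real {P : Config L | IsGood (P.pts : Set ℝ) 0 L}ᶜ := fun a => by
    rw [measureReal_congr (hX.setOf_not_isGood_ae_eq a L),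
      map_measureReal_apply (hX.measurable_config hL.le a) (Config.measurableSet_isGood hL).compl]
  have h0 := h 0
  rw [zero_add] at h0
  rw [h, h0, hX.map_config_eq hL.le a 0]

theorem measureReal_not_isGood_inter (hX : IsUnitPoissonProcess Pr X) {L : ℝ} (hL : 0 < L)
    {a b : ℝ} (hab : a + L ≤ b) :
    Pr.real ({ω | ¬ IsGood (X ω) a (a + L)} ∩ {ω | ¬ IsGood (X ω) b (b + L)}) =
      Pr.real {ω | ¬ IsGood (X ω) 0 L} ^ 2 := by
  have hm := (Config.measurableSet_isGood hL).compl
  rw [measureReal_congr ((hX.setOf_not_isGood_ae_eq a L).inter (hX.setOf_not_isGood_ae_eq b L)),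
    measureReal_def, (hX.indepFun_config hL.le hab).measure_inter_preimage_eq_mul _ _ hm hm,
    ENNReal.toReal_mul, ← measureReal_def, ← measureReal_def,
    ← measureReal_congr (hX.setOf_not_isGood_ae_eq a L),
    ← measureReal_congr (hX.setOf_not_isGood_ae_eq b L), hX.measureReal_not_isGood hL,
    hX.measureReal_not_isGood hL, sq]

/-- The renormalization inequality. -/
theorem measureReal_not_isGood_seven_mul_le (hX : IsUnitPoissonProcess Pr X) {L : ℝ} (hL : 0 < L) :
    Pr.real {ω | ¬ IsGood (X ω) 0 (7 * L)} ≤ 11 * Pr.real {ω | ¬ IsGood (X ω) 0 L} ^ 2 := by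
  let B : ℕ → Set Ω := fun i => {ω | ¬ IsGood (X ω) (i * (L / 2)) (i * (L / 2) + L)}
  have hsub : {ω | ¬ IsGood (X ω) 0 (7 * L)} ≤ᵐ[Pr] ⋃ i : Fin 11, B i ∩ B (i + 2) := by
    filter_upwards [hX.ae_isoscelesFree] with ω hiso hω
    by_contra hcon
    refine hω (isGood_of_isGood_or hL (hX.finite_inter_Icc ω _ _) hiso fun i hi => ?_)
    by_contra! h
    exact hcon (mem_iUnion.2 ⟨⟨i, by omega⟩, h.1, h.2⟩)
  calc Pr.real {ω | ¬ IsGood (X ω) 0 (7 * L)} ≤ Pr.real (⋃ i : Fin 11, B i ∩ B (i + 2)) :=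
        ENNReal.toReal_mono (measure_ne_top _ _) (measure_mono_ae hsub)
    _ ≤ ∑ i : Fin 11, Pr.real (B i ∩ B (i + 2)) := measureReal_iUnion_fintype_le _
    _ = ∑ _i : Fin 11, Pr.real {ω | ¬ IsGood (X ω) 0 L} ^ 2 :=
      Finset.sum_congr rfl fun i _ => hX.measureReal_not_isGood_inter hL (by push_cast; linarith)
    _ = _ := by simp

/-- Below `1 / 22` the quadratic inequality at least halves the probability: `11 * q ^ 2 ≤ q / 2`.
-/
theorem measureReal_not_isGood_pow_le (hX : IsUnitPoissonProcess Pr X) {L : ℝ} (hL : 0 < L)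
    (h : Pr.real {ω | ¬ IsGood (X ω) 0 L} ≤ 1 / 22) (n : ℕ) :
    Pr.real {ω | ¬ IsGood (X ω) 0 (7 ^ n * L)} ≤ 1 / 22 * (1 / 2) ^ n := by
  induction n with
  | zero => simpa using h
  | succ n ih =>
    have h1 := hX.measureReal_not_isGood_seven_mul_le (L := 7 ^ n * L) (by positivity)
    have h2 : (0 : ℝ) ≤ Pr.real {ω | ¬ IsGood (X ω) 0 (7 ^ n * L)} := measureReal_nonneg
    have h3 : (1 / 2 : ℝ) ^ n ≤ 1 := pow_le_one₀ (by norm_num) (by norm_num)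
    rw [← mul_assoc, ← pow_succ'] at h1
    rw [pow_succ (1 / 2 : ℝ)]
    nlinarith

theorem ae_eventually_isGood (hX : IsUnitPoissonProcess Pr X) {L : ℝ} (hL : 0 < L)
    (h : Pr.real {ω | ¬ IsGood (X ω) 0 L} ≤ 1 / 22) :
    ∀ᵐ ω ∂Pr, ∀ᶠ n : ℕ in Filter.atTop, ∀ i : ℤ, -1 ≤ i → i ≤ 9 →
      IsGood (X ω) (i * (7 ^ n * L / 2)) (i * (7 ^ n * L / 2) + 7 ^ n * L) := by
  have hi : ∀ i : ℤ, ∀ᵐ ω ∂Pr, ∀ᶠ n : ℕ in Filter.atTop,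
      IsGood (X ω) (i * (7 ^ n * L / 2)) (i * (7 ^ n * L / 2) + 7 ^ n * L) := by
    intro i
    have hsum : ∑' n : ℕ, Pr {ω | ¬ IsGood (X ω) (i * (7 ^ n * L / 2))
        (i * (7 ^ n * L / 2) + 7 ^ n * L)} ≠ ⊤ := by
      refine ne_top_of_le_ne_top (b := ∑' n : ℕ, ENNReal.ofReal (1 / 22 * (1 / 2) ^ n)) ?_
        (ENNReal.tsum_le_tsum fun n => ?_)
      · exact (summable_geometric_two.mul_left _).tsum_ofReal_ne_top
      · rw [← ofReal_measureReal, hX.measureReal_not_isGood (by positivity)]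
        exact ENNReal.ofReal_le_ofReal (hX.measureReal_not_isGood_pow_le hL h n)
    filter_upwards [ae_eventually_notMem hsum] with ω hω
    filter_upwards [hω] with n hn
    exact not_not.1 hn
  filter_upwards [ae_all_iff.2 hi] with ω hω
  have := (Filter.eventually_all_finset (Finset.Icc (-1 : ℤ) 9)).2 fun i _ => hω i
  filter_upwards [this] with n hn i h1 h2
  exact hn i (Finset.mem_Icc.2 ⟨h1, h2⟩)

theorem measureReal_not_isGood_eq (hX : IsUnitPoissonProcess Pr X) {L : ℝ} (hL : 0 < L) :
    Pr.real {ω | ¬ IsGood (X ω) 0 L} = 1 - Pr.real {ω | IsGood (X ω) 0 L} := by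
  have hae := hX.setOf_not_isGood_ae_eq 0 L
  rw [zero_add] at hae
  have hm := hX.measurable_config hL.le 0 (Config.measurableSet_isGood hL)
  have hae' : {ω | IsGood (X ω) 0 L} =ᵐ[Pr]
      hX.config 0 L ⁻¹' {P : Config L | IsGood (P.pts : Set ℝ) 0 L} := by
    have := hae.compl
    rwa [← preimage_compl, compl_compl, ← compl_ofPred, compl_compl] at this
  rw [measureReal_congr hae, measureReal_congr hae', preimage_compl, probReal_compl_eq_one_sub hm]

end IsUnitPoissonProcess

theorem theorem4p2 {Ω : Type*} [MeasurableSpace Ω] (Pr : Measure Ω) [IsProbabilityMeasure Pr]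
    (X : Ω → Set ℝ) (hX : IsUnitPoissonProcess Pr X)
    (hgood : ∃ L : ℝ, (0.968 : ℝ) < Pr.real {ω | IsGood (X ω) 0 L}) :
    ∀ᵐ ω ∂Pr,
      (∃! G : SimpleGraph ℝ, IsStableMultiMatching (X ω) (fun _ => 2) G) ∧
        ∀ G : SimpleGraph ℝ, IsStableMultiMatching (X ω) (fun _ => 2) G →
          HasInfiniteComponent G := by
  obtain ⟨L, hL⟩ := hgood
  have hL0 := hX.pos_of_measureReal_isGood_pos (lt_trans (by norm_num) hL)
  -- Here `1 - 0.968 = 0.032`, below `1 / 22 ≈ 0.045`.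
  have hbad : Pr.real {ω | ¬ IsGood (X ω) 0 L} ≤ 1 / 22 := by
    rw [hX.measureReal_not_isGood_eq hL0]
    norm_num at hL ⊢
    linarith
  filter_upwards [hX.ae_eventually_isGood hL0 hbad] with ω hω
  exact existsUnique_of_eventually_isGood (hX.finite_inter_Icc ω) hL0 hω
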